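/- **Setting.** Let $(X,d,\mu)$ be a metric measure space, i.e. a metric space with a Borel measure such that $0<\mu(B(x,r))<\infty$ for all $x\in X$, $r>0$, and assume that $X$ is bounded. A function $q:X\to(0,\infty)$ is called a *bounded log-Hölder exponent* (written $q\in\mathcal P_b^{\log}(X)$) if it is measurable, essentially bounded, $\operatorname{ess\,inf} q>0$, and there is $L>0$ with $\left|\frac1{q(x)}-\frac1{q(y)}\right|\le \frac{L}{\log(e+1/d(x,y))}$ for all $x\ne y$. For exponents write $q\ll r$ (or $r\gg q$) if $\operatorname{ess\,inf}(r-q)>0$. For such $q$, $L^{q(\cdot)}(X)$ is the space of measurable $f$ with $\int_X|f|^{q(x)}\,d\mu<\infty$, with quasi-norm $\|f\|_{L^{q(\cdot)}}=\inf\{\lambda>0:\int_X|f/\lambda|^{q(x)}\,d\mu\le1\}$. For a measurable, a.e. finite $u:X\to[-\infty,\infty]$, $\mathcal D^{s(\cdot)}(u)$ is the set of functions $g:X\to[0,\infty]$ for which there is a null set $N$ with $|u(x)-u(y)|\le d(x,y)^{s(x)}g(x)+d(x,y)^{s(y)}g(y)$ for all $x,y\in X\setminus N$. The space $\dot M^{s(\cdot),p(\cdot)}(X)$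 consists of those $u$ with $\mathcal D^{s(\cdot)}(u)\cap L^{p(\cdot)}(X)\neq\emptyset$, and $M^{s(\cdot),p(\cdot)}(X)=\dot M^{s(\cdot),p(\cdot)}(X)\cap L^{p(\cdot)}(X)$. Finally $u_X=\frac1{\mu(X)}\int_X u\,d\mu$. **Theorem.** Let $(X,d,\mu)$ be a bounded metric measure space, and let $Q\in\mathcal P_b^{\log}(X)$, $\delta\in(0,\infty)$, $b\in(0,1]$ be such that $\mu(B(x,r))\ge b\,r^{Q(x)}$ for all $x\in X$ and $r\in(0,\delta]$. Let $p,s\in\mathcal P_b^{\log}(X)$. In the following, dependence of a constant on $p,s,Q$ means dependence only on positive lower bounds for their essential infima, upper bounds for their essential suprema, log-Hölder constants of $1/p,1/s,1/Q$, and, in (i) and (iii), a positive lower bound for $\operatorname{ess\,inf}(Q-sp)$, respectively $\operatorname{ess\,inf}(sp-Q)$. (i) If $sp\ll Q$ and $\gamma:=\frac{Qp}{Q-sp}$, there is a constant $\hat C_S>0$, depending only on $b,\delta,\operatorname{diam}X,\mu(X),p,s,Q$, such that for all $u\in\dot M^{s(\cdot),p(\cdot)}(X)$ and $g\in\mathcal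 D^{s(\cdot)}(u)\cap L^{p(\cdot)}(X)$ $$\inf_{c\in\mathbb R}\|u-c\|_{L^{\gamma(\cdot)}(X)}\le\hat C_S\|g\|_{L^{p(\cdot)}(X)},$$ and for all $u\in M^{s(\cdot),p(\cdot)}(X)$ and $g\in\mathcal D^{s(\cdot)}(u)\cap L^{p(\cdot)}(X)$ $$\|u\|_{L^{\gamma(\cdot)}(X)}\le\hat C_S\left(\|u\|_{L^{p(\cdot)}(X)}+\|g\|_{L^{p(\cdot)}(X)}\right).$$ (ii) If $sp=Q$, there are constants $\hat C_{MT1},\hat C_{MT2}>0$, depending only on $b,\delta,\operatorname{diam}X,p,s,Q$, such that for all $u\in\dot M^{s(\cdot),p(\cdot)}(X)$ and $g\in\mathcal D^{s(\cdot)}(u)\cap L^{p(\cdot)}(X)$ the function $u$ is integrable on $X$ and, if $\|g\|_{L^{p(\cdot)}(X)}>0$, $$\frac1{\mu(X)}\int_X\exp\left(\hat C_{MT1}\frac{|u(x)-u_X|}{\|g\|_{L^{p(\cdot)}(X)}}\right)d\mu(x)\le\hat C_{MT2}.$$ (iii) If $sp\gg Q$ and $\alpha:=s-\frac Qp$, there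 are constants $\hat C_H,\hat D_H>0$, depending only on $b,\delta,\operatorname{diam}X,p,s,Q$, such that for all $u\in\dot M^{s(\cdot),p(\cdot)}(X)$ and $g\in\mathcal D^{s(\cdot)}(u)\cap L^{p(\cdot)}(X)$ the function $u$ is integrable on $X$, $$\|u-u_X\|_{L^\infty(X)}\le\hat C_H\|g\|_{L^{p(\cdot)}(X)},$$ and there is a continuous $\tilde u:X\to\mathbb R$ with $\tilde u=u$ a.e. such that for all $x,y\in X$ $$|\tilde u(x)-\tilde u(y)|\le\hat D_H\,\|g\|_{L^{p(\cdot)}(X)}\,d(x,y)^{\alpha(x)}.$$ -/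

import Mathlib

open MeasureTheory Set
open scoped ENNReal

universe v

namespace VarExp

variable {X : Type*}

/-- A metric measure space: every ball of positive radius has positive and finite measure. -/
def IsMetricMeasure [MetricSpace X] [MeasurableSpace X] (μ : Measure X) : Prop :=
  ∀ (x : X) (r : ℝ), 0 < r → 0 < μ (Metric.ball x r) ∧ μ (Metric.ball x r) < ∞

/-- The lower bound `μ (B(x,r)) ≥ b * r ^ Q(x)` for all points `x` and all radii `0 < r ≤ δ`. -/
def LowerRegular [MetricSpace X] [MeasurableSpace X] (μ : Measure X) (Q : X → ℝ) (b δ : ℝ) :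
    Prop :=
  ∀ (x : X) (r : ℝ), 0 < r → r ≤ δ → ENNReal.ofReal (b * r ^ Q x) ≤ μ (Metric.ball x r)

/-- `f` is locally log-Hölder continuous on `X` with constant `L`.
(For `x = y` the condition is trivial, as the left side is `0`.) -/
def LogHolderWith [MetricSpace X] (L : ℝ) (f : X → ℝ) : Prop :=
  0 < L ∧ ∀ x y : X, |f x - f y| ≤ L / Real.log (Real.exp 1 + 1 / dist x y)

/-- Numerical data controlling a bounded log-Hölder exponent `p`: a lower bound for the essential
infimum, an upper bound for the essential supremum, a log-Hölder constant of `1 / p`. -/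
structure ExpBounds where
  lower : ℝ
  upper : ℝ
  logConst : ℝ

/-- `p` is a bounded variable exponent such that `1 / p` is locally log-Hölder continuous, with
bounds and log-Hölder constant controlled by `K`. Thus `p` belongs to the class of bounded
log-Hölder exponents on `X` if and only if this holds for some `K`. -/
structure IsLogExponent [MetricSpace X] [MeasurableSpace X] (μ : Measure X) (K : ExpBounds)
    (p : X → ℝ) : Prop where
  measurable : Measurable p
  pos : ∀ x, 0 < p x
  lower_pos : 0 < K.lower
  lower_le : ∀ᵐ x ∂μ, K.lower ≤ p x
  le_upper : ∀ᵐ x ∂μ, p x ≤ K.upper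
  logHolder : LogHolderWith K.logConst (fun x => 1 / p x)

/-- The semi-modular of the variable exponent Lebesgue space, for functions with values
in `[0,∞]` (a function `u` with values in `[-∞,∞]` is represented by `|u|`). -/
noncomputable def modular [MeasurableSpace X] (μ : Measure X) (p : X → ℝ) (f : X → ℝ≥0∞) :
    ℝ≥0∞ :=
  ∫⁻ x, f x ^ p x ∂μ

/-- The Luxemburg quasi-norm, with `inf ∅ = ∞`. -/
noncomputable def luxNorm [MeasurableSpace X] (μ : Measure X) (p : X → ℝ) (f : X → ℝ≥0∞) :
    ℝ≥0∞ :=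
  sInf {t : ℝ≥0∞ | 0 < t ∧ t < ∞ ∧ modular μ p (fun x => f x / t) ≤ 1}

/-- Membership of a non-negative function in the variable exponent Lebesgue space
(for a bounded exponent). -/
def MemVarLp [MeasurableSpace X] (μ : Measure X) (p : X → ℝ) (f : X → ℝ≥0∞) : Prop :=
  Measurable f ∧ modular μ p f < ∞

/-- The function `|u - c|` with values in `[0,∞]`. -/
noncomputable def absSub (u : X → EReal) (c : ℝ) : X → ℝ≥0∞ :=
  fun x => (u x - (c : EReal)).abs

/-- The scalar `s(·)`-gradients of `u`. -/
def ScalarGradients [MetricSpace X] [MeasurableSpace X] (μ : Measure X) (s : X → ℝ)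
    (u : X → EReal) : Set (X → ℝ≥0∞) :=
  {g | ∃ N : Set X, μ N = 0 ∧ ∀ x ∉ N, ∀ y ∉ N,
    (u x - u y).abs ≤
      ENNReal.ofReal (dist x y ^ s x) * g x + ENNReal.ofReal (dist x y ^ s y) * g y}

/-- The homogeneous Hajłasz-Sobolev functional: infimum of the norms of all
scalar gradients in the Lebesgue space, with `inf ∅ = ∞`. -/
noncomputable def homNorm [MetricSpace X] [MeasurableSpace X] (μ : Measure X) (s p : X → ℝ)
    (u : X → EReal) : ℝ≥0∞ :=
  ⨅ g ∈ {g : X → ℝ≥0∞ | g ∈ ScalarGradients μ s u ∧ MemVarLp μ p g}, luxNorm μ p g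

/-- The homogeneous Hajłasz-Sobolev space. -/
def HomSobolev [MetricSpace X] [MeasurableSpace X] (μ : Measure X) (s p : X → ℝ) :
    Set (X → EReal) :=
  {u | Measurable u ∧ (∀ᵐ x ∂μ, u x ≠ ⊤ ∧ u x ≠ ⊥) ∧ homNorm μ s p u < ∞}

/-- The inhomogeneous Hajłasz-Sobolev space. -/
def Sobolev [MetricSpace X] [MeasurableSpace X] (μ : Measure X) (s p : X → ℝ) :
    Set (X → EReal) :=
  {u | u ∈ HomSobolev μ s p ∧ MemVarLp μ p (fun x => (u x).abs)}

/-- The integral average of an almost everywhere finite function over the whole space. -/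
noncomputable def mean [MeasurableSpace X] (μ : Measure X) (u : X → EReal) : ℝ :=
  ⨍ x, (u x).toReal ∂μ

/-- A bounded metric measure space of diameter `D` satisfying the lower bound
`μ (B(x,r)) ≥ b * r ^ Q(x)` for `0 < r ≤ δ`, with bounded log-Hölder exponents `Q`, `p`, `s`
controlled by `KQ`, `Kp`, `Ks`. -/
structure Setting [MetricSpace X] [MeasurableSpace X] (μ : Measure X) (Q p s : X → ℝ)
    (b δ D : ℝ) (KQ Kp Ks : ExpBounds) : Prop where
  metricMeasure : IsMetricMeasure μ
  bounded : Bornology.IsBounded (univ : Set X)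
  diam_eq : Metric.diam (univ : Set X) = D
  lowerRegular : LowerRegular μ Q b δ
  expQ : IsLogExponent μ KQ Q
  expP : IsLogExponent μ Kp p
  expS : IsLogExponent μ Ks s

end VarExp

/-!
At a scale `t` with `∫ (g / t) ^ p ≤ 1`, the level set `E j = {(g / t) ^ p ≤ 2 ^ j}` misses only
measure `2 ^ (-j)`, so by the lower bound for the measure of balls it has a point at distance of
order `2 ^ (-(j / Q x))` from any given `x`. At such distances the log-Hölder condition allows the
exponents to be evaluated at `x`, and the gradient inequality bounds the increment of `u` between
two points of `E j` near `x` by a multiple of `t * 2 ^ (j * (1 / p x - s x / Q x))`. Summing these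
geometric bounds along a chain through `E j, …, E k`, which ends at `x`, gives:
* if `s p < Q`, the last term dominates: `|u x|` grows like `(1 + (g x / t) ^ p x) ^ (1 / γ x)`;
* if `s p = Q`, all terms are equal: `|u x|` grows like `log (1 + (g x / t) ^ p x)`;
* if `s p > Q`, the first term dominates, and choosing `j` with `2 ^ (-(j / Q x)) ≈ dist x y` makes
  it `dist x y ^ (s x - Q x / p x)`.
-/

namespace VarExp

variable {X : Type*}

section LogHolder

variable [MetricSpace X] {L R U : ℝ} {f : X → ℝ}

lemma one_le_log_exp_add (x y : X) : 1 ≤ Real.log (Real.exp 1 + 1 / dist x y) := by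
  rw [Real.le_log_iff_exp_le (by positivity)]
  exact le_add_of_nonneg_right (by positivity)

lemma neg_log_dist_le {x y : X} (h : x ≠ y) :
    -Real.log (dist x y) ≤ Real.log (Real.exp 1 + 1 / dist x y) := by
  have hd : 0 < dist x y := dist_pos.2 h
  rw [← Real.log_inv, ← one_div]
  exact Real.log_le_log (by positivity) (le_add_of_nonneg_left (Real.exp_pos 1).le)

lemma LogHolderWith.nat_mul_abs_sub_le (hf : LogHolderWith L f) (hR : 0 < R) (hU : 0 < U)
    {j : ℕ} {x y : X} (h : dist x y ≤ R * 2 ^ (-(j / U))) :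
    j * |f x - f y| ≤ L * ((1 + |Real.log R|) * U / Real.log 2) := by
  have hL := hf.1
  rcases eq_or_ne x y with rfl | hxy
  · simp only [sub_self, abs_zero, mul_zero]
    positivity
  have hlog : Real.log (dist x y) ≤ Real.log R - j / U * Real.log 2 := by
    have := Real.log_le_log (dist_pos.2 hxy) h
    rw [Real.log_mul hR.ne' (by positivity), Real.log_rpow two_pos] at this
    linarith
  have hone := one_le_log_exp_add x y
  have hneg := neg_log_dist_le hxy
  have hdiff := hf.2 x y
  set l := Real.log (Real.exp 1 + 1 / dist x y)
  have hj : (j : ℝ) ≤ l * ((1 + |Real.log R|) * U / Real.log 2) := by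
    have hscale : j / U * Real.log 2 ≤ l * (1 + |Real.log R|) := by
      nlinarith [le_abs_self (Real.log R), abs_nonneg (Real.log R)]
    calc (j : ℝ) = j / U * Real.log 2 * (U / Real.log 2) := by field_simp
      _ ≤ l * (1 + |Real.log R|) * (U / Real.log 2) := by gcongr
      _ = _ := by ring
  calc (j : ℝ) * |f x - f y| ≤ l * ((1 + |Real.log R|) * U / Real.log 2) * (L / l) := by gcongr
    _ = L * ((1 + |Real.log R|) * U / Real.log 2) := by field_simp

lemma LogHolderWith.continuous (hf : LogHolderWith L f) : Continuous f := by
  rw [Metric.continuous_iff]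
  intro x ε hε
  refine ⟨Real.exp (-(L / ε)), Real.exp_pos _, fun y hy => ?_⟩
  rw [Real.dist_eq]
  rcases eq_or_ne y x with rfl | hyx
  · simpa using hε
  have hlog : Real.log (dist y x) < -(L / ε) :=
    (Real.log_lt_iff_lt_exp (dist_pos.2 hyx)).2 hy
  have hlarge : L / ε < Real.log (Real.exp 1 + 1 / dist y x) := by
    linarith [neg_log_dist_le hyx]
  refine (hf.2 y x).trans_lt ?_
  rw [div_lt_iff₀ (by linarith [one_le_log_exp_add y x])]
  exact (div_lt_iff₀' hε).1 hlarge

lemma continuous_of_logHolderWith_one_div {p : X → ℝ} (hp : ∀ x, 0 < p x)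
    (hlog : LogHolderWith L fun x => 1 / p x) : Continuous p := by
  simpa only [one_div, Pi.inv_def, inv_inv] using
    hlog.continuous.inv₀ fun x => (one_div_pos.2 (hp x)).ne'

end LogHolder

/-- An exponent obeying the bounds `K` at every point, not only almost everywhere. -/
structure IsUniformExponent [MetricSpace X] (K : ExpBounds) (p : X → ℝ) : Prop where
  lower_pos : 0 < K.lower
  lower_le : ∀ x, K.lower ≤ p x
  le_upper : ∀ x, p x ≤ K.upper
  logHolder : LogHolderWith K.logConst (fun x => 1 / p x)

/-- The bound for `j * |1 / p x - 1 / p y|` at distances `dist x y ≤ R * 2 ^ (-(j / U))`. -/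
noncomputable def ExpBounds.oscConst (K : ExpBounds) (U R : ℝ) : ℝ :=
  K.logConst * ((1 + |Real.log R|) * U / Real.log 2)

lemma two_rpow_mul_le_of_mul_abs_sub_le {M a a' : ℝ} {j : ℕ} (h : j * |a - a'| ≤ M) :
    (2 : ℝ) ^ (j * a) ≤ 2 ^ M * 2 ^ (j * a') := by
  rw [← Real.rpow_add two_pos]
  refine Real.rpow_le_rpow_of_exponent_le one_le_two ?_
  have : (j : ℝ) * (a - a') ≤ j * |a - a'| := by gcongr; exact le_abs_self _
  linarith

namespace IsUniformExponent

variable [MetricSpace X] {K : ExpBounds} {p : X → ℝ} {U R : ℝ}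

lemma pos (hp : IsUniformExponent K p) (x : X) : 0 < p x :=
  hp.lower_pos.trans_le (hp.lower_le x)

lemma upper_pos (hp : IsUniformExponent K p) (x : X) : 0 < K.upper :=
  (hp.pos x).trans_le (hp.le_upper x)

lemma continuous (hp : IsUniformExponent K p) : Continuous p :=
  continuous_of_logHolderWith_one_div hp.pos hp.logHolder

lemma one_div_le (hp : IsUniformExponent K p) (x : X) : 1 / p x ≤ 1 / K.lower :=
  one_div_le_one_div_of_le hp.lower_pos (hp.lower_le x)

lemma nat_mul_abs_one_div_sub_le (hp : IsUniformExponent K p) (hR : 0 < R) (hU : 0 < U)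
    {j : ℕ} {x y : X} (h : dist x y ≤ R * 2 ^ (-(j / U))) :
    j * |1 / p x - 1 / p y| ≤ K.oscConst U R :=
  hp.logHolder.nat_mul_abs_sub_le hR hU h

lemma nat_mul_abs_sub_le (hp : IsUniformExponent K p) (hR : 0 < R) (hU : 0 < U)
    {j : ℕ} {x y : X} (h : dist x y ≤ R * 2 ^ (-(j / U))) :
    j * |p x - p y| ≤ K.upper ^ 2 * K.oscConst U R := by
  have hx := hp.pos x
  have hy := hp.pos y
  have hdiff : |p x - p y| = p x * p y * |1 / p x - 1 / p y| := by
    rw [← abs_of_pos (mul_pos hx hy), ← abs_mul, abs_sub_comm]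
    congr 1
    field_simp
  calc j * |p x - p y| = p x * p y * (j * |1 / p x - 1 / p y|) := by rw [hdiff]; ring
    _ ≤ K.upper * K.upper * K.oscConst U R := by
      gcongr
      · exact mul_nonneg (hp.upper_pos x).le (hp.upper_pos x).le
      · exact (hp.upper_pos x).le
      · exact hp.le_upper x
      · exact hp.le_upper y
      · exact hp.nat_mul_abs_one_div_sub_le hR hU h
    _ = K.upper ^ 2 * K.oscConst U R := by ring

end IsUniformExponent

section Support

variable [MetricSpace X] [MeasurableSpace X] {μ : Measure X}

lemma IsMetricMeasure.isOpenPosMeasure (hμ : IsMetricMeasure μ) : μ.IsOpenPosMeasure where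
  open_pos U hU := by
    rintro ⟨x, hx⟩ hzero
    obtain ⟨r, hr, hrU⟩ := Metric.isOpen_iff.1 hU x hx
    exact (hμ x r hr).1.ne' (measure_mono_null hrU hzero)

lemma forall_le_of_ae_le [μ.IsOpenPosMeasure] {f g : X → ℝ} (hf : Continuous f)
    (hg : Continuous g) (h : ∀ᵐ x ∂μ, f x ≤ g x) (x : X) : f x ≤ g x := by
  have hsub := (isClosed_le hf hg).closure_subset_iff.2 (subset_refl {x | f x ≤ g x})
  rw [(Measure.dense_of_ae h).closure_eq] at hsub
  exact hsub (mem_univ x)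

lemma IsLogExponent.isUniformExponent {K : ExpBounds} {p : X → ℝ} [μ.IsOpenPosMeasure]
    (hp : IsLogExponent μ K p) : IsUniformExponent K p :=
  have hcont : Continuous p := continuous_of_logHolderWith_one_div hp.pos hp.logHolder
  ⟨hp.lower_pos, forall_le_of_ae_le continuous_const hcont hp.lower_le,
    forall_le_of_ae_le hcont continuous_const hp.le_upper, hp.logHolder⟩

end Support

/-- The numerical data on which the constants of the theorem may depend. -/
structure Params where
  b : ℝ
  δ : ℝ
  D : ℝ
  KQ : ExpBounds
  Kp : ExpBounds
  Ks : ExpBounds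
  b_pos : 0 < b
  b_le_one : b ≤ 1
  δ_pos : 0 < δ

/-- The exponents `Q`, `p`, `s` obey the bounds prescribed by `c` at every point. -/
structure UniformExponents [MetricSpace X] (c : Params) (Q p s : X → ℝ) : Prop where
  expQ : IsUniformExponent c.KQ Q
  expP : IsUniformExponent c.Kp p
  expS : IsUniformExponent c.Ks s

/-- The reciprocal `1 / p - s / Q` of the Sobolev exponent `Q p / (Q - s p)`. Its sign
distinguishes the Sobolev, Moser-Trudinger and Morrey regimes. -/
noncomputable def gap (Q p s : X → ℝ) (x : X) : ℝ :=
  1 / p x - s x / Q x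

/-- The price of replacing the exponents at a point `y` by those at a point `x` with
`dist x y ≤ R * 2 ^ (-(j / Q x))`, when measuring a length `d ≤ C * 2 ^ (-(j / Q x))`. -/
noncomputable def Params.freezeConst (c : Params) (R C : ℝ) : ℝ :=
  C ^ c.Ks.upper *
    2 ^ (c.Ks.upper ^ 2 * c.Ks.oscConst c.KQ.upper R / c.KQ.lower + c.Kp.oscConst c.KQ.upper R)

lemma Params.freezeConst_pos (c : Params) {R C : ℝ} (hC : 0 < C) : 0 < c.freezeConst R C := by
  unfold freezeConst
  positivity

namespace UniformExponents

variable [MetricSpace X] {c : Params} {Q p s : X → ℝ} {R : ℝ} {j : ℕ} {x y : X}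

lemma dist_le_upper (h : UniformExponents c Q p s) (hR : 0 ≤ R)
    (hxy : dist x y ≤ R * 2 ^ (-(j / Q x))) : dist x y ≤ R * 2 ^ (-(j / c.KQ.upper)) := by
  refine hxy.trans (mul_le_mul_of_nonneg_left ?_ hR)
  refine Real.rpow_le_rpow_of_exponent_le one_le_two (neg_le_neg ?_)
  exact div_le_div_of_nonneg_left j.cast_nonneg (h.expQ.pos x) (h.expQ.le_upper x)

lemma rpow_mul_two_rpow_le_freezeConst (h : UniformExponents c Q p s) {C d : ℝ} (hR : 0 < R)
    (hC : 1 ≤ C) (hxy : dist x y ≤ R * 2 ^ (-(j / Q x))) (hd : 0 ≤ d)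
    (hdC : d ≤ C * 2 ^ (-(j / Q x))) :
    d ^ s y * 2 ^ (j / p y) ≤ c.freezeConst R C * 2 ^ (j * gap Q p s x) := by
  have hdist := h.dist_le_upper hR.le hxy
  have hU := h.expQ.upper_pos x
  set Ms := c.Ks.upper ^ 2 * c.Ks.oscConst c.KQ.upper R
  set Mp := c.Kp.oscConst c.KQ.upper R
  have hs : j * (s x - s y) ≤ Ms :=
    (mul_le_mul_of_nonneg_left (le_abs_self _) j.cast_nonneg).trans
      (h.expS.nat_mul_abs_sub_le hR hU hdist)
  have hp : j * (1 / p y - 1 / p x) ≤ Mp :=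
    (mul_le_mul_of_nonneg_left ((le_abs_self _).trans_eq (abs_sub_comm _ _)) j.cast_nonneg).trans
      (h.expP.nat_mul_abs_one_div_sub_le hR hU hdist)
  have hMs : 0 ≤ Ms :=
    (by positivity : (0 : ℝ) ≤ j * |s x - s y|).trans (h.expS.nat_mul_abs_sub_le hR hU hdist)
  have hexp : -(j / Q x) * s y + j / p y ≤ (Ms / c.KQ.lower + Mp) + j * gap Q p s x := by
    have hsQ : j * (s x - s y) / Q x ≤ Ms / c.KQ.lower :=
      div_le_div₀ hMs hs h.expQ.lower_pos (h.expQ.lower_le x)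
    have hid : -(j / Q x) * s y + j / p y =
        j * (s x - s y) / Q x + j * (1 / p y - 1 / p x) + j * gap Q p s x := by
      unfold gap
      ring
    linarith
  calc d ^ s y * 2 ^ (j / p y) ≤ (C * 2 ^ (-(j / Q x))) ^ s y * 2 ^ (j / p y) := by
        gcongr
        exact (h.expS.pos y).le
    _ = C ^ s y * 2 ^ (-(j / Q x) * s y + j / p y) := by
      rw [Real.mul_rpow (by positivity) (by positivity), ← Real.rpow_mul two_pos.le, mul_assoc,
        ← Real.rpow_add two_pos]
    _ ≤ C ^ c.Ks.upper * 2 ^ ((Ms / c.KQ.lower + Mp) + j * gap Q p s x) := by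
      gcongr
      · exact h.expS.le_upper y
      · exact one_le_two
    _ = c.freezeConst R C * 2 ^ (j * gap Q p s x) := by
      rw [Real.rpow_add two_pos, ← mul_assoc]
      rfl

end UniformExponents

section Escape

/-- Balls centred at `z` of radius `c.radius * 2 ^ (-(j / Q z))` have measure more than
`2 * 2 ^ (-j)`, once `j ≥ c.startScale`. -/
noncomputable def Params.radius (c : Params) : ℝ :=
  (3 / c.b) ^ (1 / c.KQ.lower)

/-- The first dyadic level at which the lower bound for the measure of balls applies, that is, at
which the radius falls below `δ`. -/
noncomputable def Params.startScale (c : Params) : ℕ :=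
  ⌈Real.logb 2 (3 / c.b / (min 1 c.δ) ^ c.KQ.upper)⌉₊

lemma Params.one_le_three_div (c : Params) : 1 ≤ 3 / c.b := by
  rw [le_div_iff₀ c.b_pos]
  linarith [c.b_le_one]

variable [MetricSpace X] {c : Params} {Q : X → ℝ} {j : ℕ}

lemma IsUniformExponent.three_div_mul_le (hQ : IsUniformExponent c.KQ Q)
    (hj : c.startScale ≤ j) (z : X) : 3 / c.b * 2 ^ (-(j : ℝ)) ≤ (min 1 c.δ) ^ Q z := by
  have hb := c.b_pos
  have hm : 0 < min 1 c.δ := lt_min one_pos c.δ_pos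
  have hlarge : 3 / c.b / (min 1 c.δ) ^ c.KQ.upper ≤ 2 ^ (j : ℝ) := by
    rw [← Real.logb_le_iff_le_rpow one_lt_two (by positivity)]
    exact Nat.ceil_le.1 hj
  rw [div_le_iff₀ (by positivity)] at hlarge
  calc 3 / c.b * 2 ^ (-(j : ℝ))
      ≤ 2 ^ (j : ℝ) * (min 1 c.δ) ^ c.KQ.upper * 2 ^ (-(j : ℝ)) := by gcongr
    _ = (min 1 c.δ) ^ c.KQ.upper := by
      rw [mul_right_comm, ← Real.rpow_add two_pos, add_neg_cancel, Real.rpow_zero, one_mul]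
    _ ≤ (min 1 c.δ) ^ Q z :=
      Real.rpow_le_rpow_of_exponent_ge hm (min_le_left _ _) (hQ.le_upper z)

lemma LowerRegular.exists_notMem_dist_le [MeasurableSpace X] {μ : Measure X}
    (hreg : LowerRegular μ Q c.b c.δ) (hQ : IsUniformExponent c.KQ Q) (hj : c.startScale ≤ j)
    (z : X) {F : Set X} (hF : μ F ≤ ENNReal.ofReal (2 * 2 ^ (-(j : ℝ)))) :
    ∃ y ∉ F, dist z y ≤ c.radius * 2 ^ (-(j / Q z)) := by
  have hb := c.b_pos
  have hm : 0 < min 1 c.δ := lt_min one_pos c.δ_pos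
  have hQz := hQ.pos z
  have hpow : (0 : ℝ) < 2 ^ (-(j : ℝ)) := by positivity
  set r := (3 / c.b * 2 ^ (-(j : ℝ))) ^ (1 / Q z) with hr
  have hrδ : r ≤ c.δ := by
    refine le_trans ?_ (min_le_right 1 c.δ)
    rw [hr, one_div, Real.rpow_inv_le_iff_of_pos (by positivity) hm.le hQz]
    exact hQ.three_div_mul_le hj z
  have hbr : c.b * r ^ Q z = 3 * 2 ^ (-(j : ℝ)) := by
    rw [hr, one_div, Real.rpow_inv_rpow (by positivity) hQz.ne']
    field_simp
  have hnot : ¬ Metric.ball z r ⊆ F := by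
    intro hsub
    have hle := ((hreg z r (by positivity) hrδ).trans (measure_mono hsub)).trans hF
    rw [hbr, ENNReal.ofReal_le_ofReal_iff (by positivity)] at hle
    linarith
  obtain ⟨y, hy, hyF⟩ := not_subset.1 hnot
  refine ⟨y, hyF, (Metric.mem_ball'.1 hy).le.trans ?_⟩
  rw [hr, Real.mul_rpow (by positivity) hpow.le, ← Real.rpow_mul two_pos.le,
    show -(j : ℝ) * (1 / Q z) = -(j / Q z) by ring]
  exact mul_le_mul_of_nonneg_right
    (Real.rpow_le_rpow_of_exponent_le c.one_le_three_div (hQ.one_div_le z)) (by positivity)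

end Escape

section DyadicSums

variable {θ₀ θ η h : ℝ} {j k : ℕ}

lemma two_rpow_sub_one_pos (hη : 0 < η) : 0 < (2 : ℝ) ^ η - 1 :=
  sub_pos.2 (Real.one_lt_rpow one_lt_two hη)

lemma one_sub_two_rpow_neg_pos (hη : 0 < η) : 0 < 1 - (2 : ℝ) ^ (-η) :=
  sub_pos.2 (Real.rpow_lt_one_of_one_lt_of_neg one_lt_two (neg_neg_iff_pos.2 hη))

lemma sum_two_rpow_le_of_pos (hθ₀ : 0 < θ₀) (hθ : θ₀ ≤ θ) (hjk : j ≤ k) :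
    ∑ i ∈ Finset.Ico j k, (2 : ℝ) ^ (i * θ) ≤ ((2 : ℝ) ^ θ₀ - 1)⁻¹ * (2 ^ k) ^ θ := by
  have hone := two_rpow_sub_one_pos hθ₀
  have hle : (2 : ℝ) ^ θ₀ ≤ 2 ^ θ := Real.rpow_le_rpow_of_exponent_le one_le_two hθ
  simp only [Real.rpow_natCast_mul two_pos.le, ← Real.rpow_pow_comm two_pos.le]
  rw [geom_sum_Ico (by linarith) hjk, div_le_iff₀ (by linarith), mul_right_comm]
  have hinv : 1 ≤ ((2 : ℝ) ^ θ₀ - 1)⁻¹ * (2 ^ θ - 1) := by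
    rw [inv_mul_eq_div, one_le_div₀ (by linarith)]
    linarith
  have hpow : (0 : ℝ) ≤ (2 ^ θ) ^ j := by positivity
  exact (sub_le_self _ hpow).trans (le_mul_of_one_le_left (by positivity) hinv)

lemma sum_two_rpow_le_of_neg (hη : 0 < η) (hθ : θ ≤ -η) :
    ∑ i ∈ Finset.Ico j k, (2 : ℝ) ^ (i * θ) ≤ (1 - 2 ^ (-η))⁻¹ * 2 ^ (j * θ) := by
  have hone := one_sub_two_rpow_neg_pos hη
  have hle : (2 : ℝ) ^ θ ≤ 2 ^ (-η) := Real.rpow_le_rpow_of_exponent_le one_le_two hθ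
  simp only [Real.rpow_natCast_mul two_pos.le, ← Real.rpow_pow_comm two_pos.le]
  refine (geom_sum_Ico_le_of_lt_one (by positivity) (by linarith)).trans ?_
  rw [div_eq_inv_mul]
  gcongr

lemma exists_level_le (hh : 0 ≤ h) (j : ℕ) :
    ∃ k ≥ j, h ≤ 2 ^ k ∧ (2 : ℝ) ^ (k + 1) ≤ 2 ^ (j + 2) * (1 + h) := by
  obtain ⟨n, hle, hlt⟩ := exists_nat_pow_near (le_add_of_nonneg_right hh) one_lt_two
  refine ⟨j + n + 1, by lia, ?_, ?_⟩
  · have : (2 : ℝ) ^ (n + 1) ≤ 2 ^ (j + n + 1) := pow_le_pow_right₀ one_le_two (by lia)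
    linarith
  · calc (2 : ℝ) ^ (j + n + 1 + 1) = 2 ^ (j + 2) * 2 ^ n := by ring
      _ ≤ 2 ^ (j + 2) * (1 + h) := by gcongr

lemma natCast_sub_le_log (hh : 0 ≤ h) (hk : (2 : ℝ) ^ k ≤ 2 ^ (j + 2) * (1 + h)) :
    (k : ℝ) - j ≤ 2 * (1 + Real.log (1 + h)) := by
  have hlog := Real.log_le_log (by positivity) hk
  rw [Real.log_mul (by positivity) (by positivity), Real.log_pow, Real.log_pow] at hlog
  push_cast at hlog
  have hnonneg : 0 ≤ Real.log (1 + h) := Real.log_nonneg (by linarith)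
  have hlog2 := Real.log_two_gt_d9
  by_contra! hlt
  nlinarith

end DyadicSums

/-- The price of one step of length at most `2 * R * 2 ^ (-(j / Q x))` in a chain: the increment
of a function between two points of level `j + 1` near `x` is `2 ^ (j * gap x)` times this. -/
noncomputable def Params.stepConst (c : Params) (R : ℝ) : ℝ :=
  2 * 2 ^ (1 / c.Kp.lower) * c.freezeConst R (2 * R)

lemma Params.stepConst_pos (c : Params) {R : ℝ} (hR : 0 < R) : 0 < c.stepConst R := by
  have := c.freezeConst_pos (R := R) (C := 2 * R) (by positivity)
  unfold stepConst
  positivity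

lemma Params.one_le_radius (c : Params) (hQ : 0 < c.KQ.lower) : 1 ≤ c.radius :=
  Real.one_le_rpow c.one_le_three_div (one_div_pos.2 hQ).le

/-- An abstract form of the level sets `E j = {g ^ p ≤ 2 ^ j}` of a scalar gradient `t * g` of `v`:
each of them comes close to every point, and on `E j` the gradient at `x` is at most
`t * 2 ^ (j / p x)`. -/
structure LevelFamily [MetricSpace X] (c : Params) (Q p s : X → ℝ) (t : ℝ) (v : X → ℝ)
    (E : ℕ → Set X) : Prop where
  mono : Monotone E
  exists_near : ∀ j ≥ c.startScale, ∀ x, ∃ y ∈ E j, dist x y ≤ c.radius * 2 ^ (-(j / Q x))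
  gradient_bound : ∀ j, ∀ x ∈ E j, ∀ y ∈ E j, |v x - v y| ≤
    t * (dist x y ^ s x * 2 ^ (j / p x) + dist x y ^ s y * 2 ^ (j / p y))

namespace LevelFamily

variable [MetricSpace X] {c : Params} {Q p s v : X → ℝ} {t R : ℝ} {E : ℕ → Set X}

lemma abs_sub_le_stepConst (hE : LevelFamily c Q p s t v E) (hc : UniformExponents c Q p s)
    (ht : 0 ≤ t) (hR : 1 ≤ R) {j : ℕ} {x y z : X} (hy : y ∈ E (j + 1)) (hz : z ∈ E (j + 1))
    (hxy : dist x y ≤ R * 2 ^ (-(j / Q x))) (hxz : dist x z ≤ R * 2 ^ (-(j / Q x))) :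
    |v y - v z| ≤ t * (c.stepConst R * 2 ^ (j * gap Q p s x)) := by
  have hyz : dist y z ≤ 2 * R * 2 ^ (-(j / Q x)) := by
    linarith [dist_triangle_left y z x]
  have hterm : ∀ w, dist x w ≤ R * 2 ^ (-(j / Q x)) →
      dist y z ^ s w * 2 ^ ((j + 1 : ℕ) / p w) ≤
        2 ^ (1 / c.Kp.lower) * (c.freezeConst R (2 * R) * 2 ^ (j * gap Q p s x)) := fun w hw =>
    calc dist y z ^ s w * 2 ^ ((j + 1 : ℕ) / p w)
        = 2 ^ (1 / p w) * (dist y z ^ s w * 2 ^ (j / p w)) := by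
          rw [Nat.cast_succ, add_div, Real.rpow_add two_pos]
          ring
      _ ≤ _ := by
          gcongr ?_ * ?_
          · exact Real.rpow_le_rpow_of_exponent_le one_le_two (hc.expP.one_div_le w)
          · exact hc.rpow_mul_two_rpow_le_freezeConst (by linarith) (by linarith) hw
              dist_nonneg hyz
  refine (hE.gradient_bound (j + 1) y hy z hz).trans (mul_le_mul_of_nonneg_left ?_ ht)
  refine (add_le_add (hterm y hxy) (hterm z hxz)).trans_eq ?_
  unfold Params.stepConst
  ring

/-- All points of the chain are chosen near its end point `x`, so that no distances have to be
summed. -/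
lemma abs_sub_le_sum (hE : LevelFamily c Q p s t v E) (hc : UniformExponents c Q p s)
    (ht : 0 ≤ t) (hR : c.radius ≤ R) {j k : ℕ} {x z : X} (hj : c.startScale ≤ j) (hjk : j ≤ k)
    (hx : x ∈ E k) (hz : z ∈ E j) (hxz : dist x z ≤ R * 2 ^ (-(j / Q x))) :
    |v x - v z| ≤
      t * (c.stepConst R * ∑ i ∈ Finset.Ico j (k + 1), 2 ^ (i * gap Q p s x)) := by
  have hR1 : 1 ≤ R := (c.one_le_radius hc.expQ.lower_pos).trans hR
  induction hjk using Nat.decreasingInduction generalizing z with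
  | self =>
    rw [Nat.Ico_succ_singleton, Finset.sum_singleton]
    have hself : dist x x ≤ R * 2 ^ (-(k / Q x)) := by
      rw [dist_self]
      positivity
    exact hE.abs_sub_le_stepConst hc ht hR1 (hE.mono k.le_succ hx) (hE.mono k.le_succ hz) hself hxz
  | of_succ i hik ih =>
    obtain ⟨y, hy, hxy⟩ := hE.exists_near (i + 1) (hj.trans i.le_succ) x
    replace hxy : dist x y ≤ R * 2 ^ (-((i + 1 : ℕ) / Q x)) := hxy.trans (by gcongr)
    have hxy' : dist x y ≤ R * 2 ^ (-(i / Q x)) := by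
      have hQx := hc.expQ.pos x
      refine hxy.trans ?_
      gcongr
      · exact one_le_two
      · exact i.le_succ
    rw [Finset.sum_eq_sum_Ico_succ_bot (Nat.lt_succ_of_lt hik), mul_add, mul_add]
    calc |v x - v z| ≤ |v y - v z| + |v x - v y| :=
          (abs_sub_le (v x) (v y) (v z)).trans_eq (add_comm _ _)
      _ ≤ _ := add_le_add
        (hE.abs_sub_le_stepConst hc ht hR1 hy (hE.mono i.le_succ hz) hxy' hxz)
        (ih (hj.trans i.le_succ) hy hxy)

end LevelFamily

section Regimes

/-- A multiple of the radius `c.radius` at which the scale `c.startScale` covers the whole space. -/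
noncomputable def Params.diamRadius (c : Params) : ℝ :=
  max c.radius (c.D * 2 ^ (c.startScale / c.KQ.lower))

/-- The constant of the pointwise Sobolev estimate if `gap ≥ η`. -/
noncomputable def Params.growthConst (c : Params) (η : ℝ) : ℝ :=
  c.stepConst c.diamRadius *
    ((2 ^ η - 1)⁻¹ * (2 ^ (c.startScale + 2)) ^ (1 / c.Kp.lower))

/-- The factor comparing `2 ^ (-(j / Q x))` and `2 ^ (-(j / Q y))` at distance
`c.diamRadius * 2 ^ (-(j / Q x))`. -/
noncomputable def Params.scaleRatio (c : Params) : ℝ :=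
  2 ^ c.KQ.oscConst c.KQ.upper c.diamRadius

/-- The constant of the Hölder estimate if `gap ≤ -η`. The two summands account for the chains
from the two points to a common point between them. -/
noncomputable def Params.holderConst (c : Params) (η : ℝ) : ℝ :=
  (c.stepConst c.diamRadius + c.stepConst (2 * c.diamRadius * c.scaleRatio) *
    c.freezeConst c.diamRadius c.scaleRatio) * (1 - 2 ^ (-η))⁻¹ * 2 ^ (c.Ks.upper / c.KQ.lower)

variable (c : Params)

lemma Params.radius_le_diamRadius : c.radius ≤ c.diamRadius :=
  le_max_left _ _

lemma Params.diamRadius_pos : 0 < c.diamRadius :=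
  have : 0 < c.radius := Real.rpow_pos_of_pos (one_pos.trans_le c.one_le_three_div) _
  this.trans_le c.radius_le_diamRadius

lemma Params.growthConst_pos {η : ℝ} (hη : 0 < η) : 0 < c.growthConst η := by
  have := c.stepConst_pos c.diamRadius_pos
  have : (0 : ℝ) < 2 ^ η - 1 := two_rpow_sub_one_pos hη
  unfold growthConst
  positivity

lemma Params.scaleRatio_pos : 0 < c.scaleRatio := by
  unfold scaleRatio
  positivity

lemma Params.holderConst_pos {η : ℝ} (hη : 0 < η) : 0 < c.holderConst η := by
  have hR := c.diamRadius_pos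
  have hW := c.scaleRatio_pos
  have := c.stepConst_pos hR
  have := c.stepConst_pos (mul_pos (mul_pos two_pos hR) hW)
  have := c.freezeConst_pos (R := c.diamRadius) hW
  have := one_sub_two_rpow_neg_pos hη
  unfold holderConst
  positivity

variable {c} [MetricSpace X] {Q p s v : X → ℝ} {t η h : ℝ} {E : ℕ → Set X} {x y z : X}

lemma UniformExponents.dist_le_diamRadius (hc : UniformExponents c Q p s)
    (hD : dist x y ≤ c.D) :
    dist x y ≤ c.diamRadius * 2 ^ (-(c.startScale / Q x)) := by
  have hD0 : 0 ≤ c.D := dist_nonneg.trans hD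
  rw [Real.rpow_neg two_pos.le, ← div_eq_mul_inv, le_div_iff₀ (by positivity)]
  refine le_trans ?_ (le_max_right c.radius _)
  gcongr
  · exact one_le_two
  · exact hc.expQ.lower_pos
  · exact hc.expQ.lower_le x

lemma UniformExponents.gap_le (hc : UniformExponents c Q p s) (x : X) :
    gap Q p s x ≤ 1 / c.Kp.lower :=
  (sub_le_self _ (div_pos (hc.expS.pos x) (hc.expQ.pos x)).le).trans (hc.expP.one_div_le x)

lemma UniformExponents.one_le_scaleRatio (hc : UniformExponents c Q p s) (x : X) :
    1 ≤ c.scaleRatio := by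
  have hlog := hc.expQ.logHolder.1
  have hU := hc.expQ.upper_pos x
  refine Real.one_le_rpow one_le_two ?_
  unfold ExpBounds.oscConst
  positivity

lemma UniformExponents.two_rpow_le_scaleRatio (hc : UniformExponents c Q p s) {j : ℕ}
    (hxy : dist x y ≤ c.diamRadius * 2 ^ (-(j / Q x))) :
    (2 : ℝ) ^ (-(j / Q x)) ≤ c.scaleRatio * 2 ^ (-(j / Q y)) ∧
      (2 : ℝ) ^ (-(j / Q y)) ≤ c.scaleRatio * 2 ^ (-(j / Q x)) := by
  have hosc := hc.expQ.nat_mul_abs_one_div_sub_le c.diamRadius_pos (hc.expQ.upper_pos x)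
    (hc.dist_le_upper c.diamRadius_pos.le hxy)
  have hneg : ∀ w, -((j : ℝ) / Q w) = j * -(1 / Q w) := fun w => by ring
  rw [hneg, hneg]
  constructor <;> refine two_rpow_mul_le_of_mul_abs_sub_le (le_trans (le_of_eq ?_) hosc)
  · rw [neg_sub_neg, abs_sub_comm]
  · rw [neg_sub_neg]

lemma UniformExponents.exists_scale_dist (hc : UniformExponents c Q p s) (hxy : x ≠ y)
    (hD : dist x y ≤ c.D) :
    ∃ j ≥ c.startScale, dist x y ≤ c.diamRadius * 2 ^ (-(j / Q x)) ∧
      (2 : ℝ) ^ (-(j / Q x)) ≤ 2 ^ (1 / c.KQ.lower) * dist x y := by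
  have hQx := hc.expQ.pos x
  have hR := c.diamRadius_pos
  have hR1 : 1 ≤ c.diamRadius :=
    (c.one_le_radius hc.expQ.lower_pos).trans c.radius_le_diamRadius
  have hd := dist_pos.2 hxy
  set B := c.diamRadius * 2 ^ (-(c.startScale / Q x)) with hB
  have hBpos : 0 < B := by positivity
  obtain ⟨n, hlt, hle⟩ := exists_nat_pow_near_of_lt_one (div_pos hd hBpos)
    ((div_le_one₀ hBpos).2 (hc.dist_le_diamRadius hD))
    (show (0 : ℝ) < 2 ^ (-(1 / Q x)) by positivity)
    (Real.rpow_lt_one_of_one_lt_of_neg one_lt_two (neg_neg_iff_pos.2 (by positivity)))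
  have hscale : ∀ i : ℕ, c.diamRadius * 2 ^ (-((c.startScale + i : ℕ) / Q x)) =
      (2 ^ (-(1 / Q x))) ^ i * B := fun i => by
    rw [hB, mul_left_comm, ← Real.rpow_mul_natCast two_pos.le, ← Real.rpow_add two_pos]
    push_cast
    ring_nf
  refine ⟨c.startScale + n, le_self_add, ?_, ?_⟩
  · rw [hscale]
    exact (div_le_iff₀ hBpos).1 hle
  · have hnext : 2 ^ (-((c.startScale + (n + 1) : ℕ) / Q x)) ≤ dist x y :=
      calc (2 : ℝ) ^ (-((c.startScale + (n + 1) : ℕ) / Q x))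
          ≤ c.diamRadius * 2 ^ (-((c.startScale + (n + 1) : ℕ) / Q x)) :=
            le_mul_of_one_le_left (by positivity) hR1
        _ ≤ dist x y := by
            rw [hscale]
            exact ((lt_div_iff₀ hBpos).1 hlt).le
    calc (2 : ℝ) ^ (-((c.startScale + n : ℕ) / Q x))
        = 2 ^ (1 / Q x) * 2 ^ (-((c.startScale + (n + 1) : ℕ) / Q x)) := by
          rw [← Real.rpow_add two_pos]
          push_cast
          ring_nf
      _ ≤ 2 ^ (1 / c.KQ.lower) * dist x y := by
          gcongr
          · exact one_le_two
          · exact hc.expQ.lower_pos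
          · exact hc.expQ.lower_le x

lemma UniformExponents.sub_div_eq_neg_mul_gap (hc : UniformExponents c Q p s) (x : X) :
    s x - Q x / p x = -(Q x * gap Q p s x) := by
  have hQx := hc.expQ.pos x
  unfold gap
  field_simp
  ring

lemma UniformExponents.sub_div_le_upper (hc : UniformExponents c Q p s) (x : X) :
    s x - Q x / p x ≤ c.Ks.upper :=
  (sub_le_self _ (div_pos (hc.expQ.pos x) (hc.expP.pos x)).le).trans (hc.expS.le_upper x)

lemma UniformExponents.two_rpow_mul_gap_le (hc : UniformExponents c Q p s)
    (hgap : gap Q p s x ≤ 0) {j : ℕ}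
    (hscale : (2 : ℝ) ^ (-(j / Q x)) ≤ 2 ^ (1 / c.KQ.lower) * dist x y) :
    (2 : ℝ) ^ (j * gap Q p s x) ≤
      2 ^ (c.Ks.upper / c.KQ.lower) * dist x y ^ (s x - Q x / p x) := by
  have hQx := hc.expQ.pos x
  have hlower := hc.expQ.lower_pos
  have hα : 0 ≤ s x - Q x / p x := by
    rw [hc.sub_div_eq_neg_mul_gap, neg_nonneg]
    exact mul_nonpos_of_nonneg_of_nonpos hQx.le hgap
  calc (2 : ℝ) ^ (j * gap Q p s x) = (2 ^ (-(j / Q x))) ^ (s x - Q x / p x) := by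
        rw [← Real.rpow_mul two_pos.le, hc.sub_div_eq_neg_mul_gap]
        congr 1
        field_simp
    _ ≤ (2 ^ (1 / c.KQ.lower) * dist x y) ^ (s x - Q x / p x) := by gcongr
    _ = 2 ^ ((s x - Q x / p x) / c.KQ.lower) * dist x y ^ (s x - Q x / p x) := by
        rw [Real.mul_rpow (by positivity) dist_nonneg, ← Real.rpow_mul two_pos.le,
          one_div_mul_eq_div]
    _ ≤ _ := by
        gcongr
        · exact one_le_two
        · exact hc.sub_div_le_upper x

namespace LevelFamily

lemma abs_sub_le_sum_startScale (hE : LevelFamily c Q p s t v E) (hc : UniformExponents c Q p s)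
    (ht : 0 ≤ t) (hD : dist x z ≤ c.D) (hz : z ∈ E c.startScale) {k : ℕ}
    (hk : c.startScale ≤ k) (hx : x ∈ E k) :
    |v x - v z| ≤ t * (c.stepConst c.diamRadius *
      ∑ i ∈ Finset.Ico c.startScale (k + 1), 2 ^ (i * gap Q p s x)) :=
  hE.abs_sub_le_sum hc ht c.radius_le_diamRadius le_rfl hk hx hz (hc.dist_le_diamRadius hD)

lemma abs_sub_le_rpow_gap (hE : LevelFamily c Q p s t v E) (hc : UniformExponents c Q p s)
    (ht : 0 ≤ t) (hD : dist x z ≤ c.D) (hz : z ∈ E c.startScale) (hη : 0 < η)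
    (hgap : η ≤ gap Q p s x) (hh : 0 ≤ h) (hx : ∀ k : ℕ, h ≤ 2 ^ k → x ∈ E k) :
    |v x - v z| ≤ t * (c.growthConst η * (1 + h) ^ gap Q p s x) := by
  obtain ⟨k, hjk, hk, hk'⟩ := exists_level_le hh c.startScale
  refine (hE.abs_sub_le_sum_startScale hc ht hD hz hjk (hx k hk)).trans ?_
  have hstep := c.stepConst_pos c.diamRadius_pos
  have hG : (0 : ℝ) < 2 ^ η - 1 := two_rpow_sub_one_pos hη
  have hsum : ∑ i ∈ Finset.Ico c.startScale (k + 1), (2 : ℝ) ^ (i * gap Q p s x) ≤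
      (2 ^ η - 1)⁻¹ * ((2 ^ (c.startScale + 2)) ^ (1 / c.Kp.lower) * (1 + h) ^ gap Q p s x) :=
    calc ∑ i ∈ Finset.Ico c.startScale (k + 1), (2 : ℝ) ^ (i * gap Q p s x)
        ≤ (2 ^ η - 1)⁻¹ * (2 ^ (k + 1)) ^ gap Q p s x :=
          sum_two_rpow_le_of_pos hη hgap (by lia)
      _ ≤ (2 ^ η - 1)⁻¹ * (2 ^ (c.startScale + 2) * (1 + h)) ^ gap Q p s x := by
          gcongr
          exact hη.le.trans hgap
      _ ≤ _ := by
          rw [Real.mul_rpow (by positivity) (by positivity)]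
          gcongr
          · exact one_le_pow₀ one_le_two
          · exact hc.gap_le x
  unfold Params.growthConst
  rw [mul_assoc _ _ ((1 + h) ^ _), mul_assoc _ _ ((1 + h) ^ _)]
  gcongr

lemma abs_sub_le_log (hE : LevelFamily c Q p s t v E) (hc : UniformExponents c Q p s)
    (ht : 0 ≤ t) (hD : dist x z ≤ c.D) (hz : z ∈ E c.startScale) (hgap : gap Q p s x = 0)
    (hh : 0 ≤ h) (hx : ∀ k : ℕ, h ≤ 2 ^ k → x ∈ E k) :
    |v x - v z| ≤ t * (2 * c.stepConst c.diamRadius * (1 + Real.log (1 + h))) := by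
  obtain ⟨k, hjk, hk, hk'⟩ := exists_level_le hh c.startScale
  refine (hE.abs_sub_le_sum_startScale hc ht hD hz hjk (hx k hk)).trans ?_
  have hstep := c.stepConst_pos c.diamRadius_pos
  have hcard : ((k + 1 : ℕ) : ℝ) - c.startScale ≤ 2 * (1 + Real.log (1 + h)) :=
    natCast_sub_le_log hh hk'
  rw [mul_comm 2, mul_assoc]
  simp only [hgap, mul_zero, Real.rpow_zero, Finset.sum_const, Nat.card_Ico, nsmul_eq_mul, mul_one]
  rw [Nat.cast_sub (by lia)]
  gcongr

lemma abs_sub_le_two_rpow (hE : LevelFamily c Q p s t v E) (hc : UniformExponents c Q p s)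
    (ht : 0 ≤ t) (hη : 0 < η) (hgap : gap Q p s x ≤ -η) {R : ℝ} (hR : c.radius ≤ R) {j k : ℕ}
    (hj : c.startScale ≤ j) (hjk : j ≤ k) (hx : x ∈ E k) (hz : z ∈ E j)
    (hxz : dist x z ≤ R * 2 ^ (-(j / Q x))) :
    |v x - v z| ≤ t * (c.stepConst R * (1 - 2 ^ (-η))⁻¹ * 2 ^ (j * gap Q p s x)) := by
  have hstep := c.stepConst_pos (one_pos.trans_le ((c.one_le_radius hc.expQ.lower_pos).trans hR))
  refine (hE.abs_sub_le_sum hc ht hR hj hjk hx hz hxz).trans ?_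
  rw [mul_assoc]
  gcongr
  exact sum_two_rpow_le_of_neg hη hgap

lemma abs_sub_le_two_rpow_of_dist_le (hE : LevelFamily c Q p s t v E)
    (hc : UniformExponents c Q p s) (ht : 0 ≤ t) (hη : 0 < η) (hgap : ∀ x, gap Q p s x ≤ -η)
    {j k : ℕ} (hj : c.startScale ≤ j) (hjk : j ≤ k) (hx : x ∈ E k) (hy : y ∈ E k)
    (hxy : dist x y ≤ c.diamRadius * 2 ^ (-(j / Q x))) :
    |v x - v y| ≤ t * ((c.stepConst c.diamRadius +
      c.stepConst (2 * c.diamRadius * c.scaleRatio) * c.freezeConst c.diamRadius c.scaleRatio) *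
        (1 - 2 ^ (-η))⁻¹ * 2 ^ (j * gap Q p s x)) := by
  have hG := inv_pos.2 (one_sub_two_rpow_neg_pos hη)
  have hR := c.diamRadius_pos
  have hW := hc.one_le_scaleRatio x
  obtain ⟨hxy', hyx'⟩ := hc.two_rpow_le_scaleRatio hxy
  obtain ⟨z, hz, hxz⟩ := hE.exists_near j hj x
  replace hxz : dist x z ≤ c.diamRadius * 2 ^ (-(j / Q x)) :=
    hxz.trans (by gcongr; exact c.radius_le_diamRadius)
  set R := 2 * c.diamRadius * c.scaleRatio
  have hstep := c.stepConst_pos (R := R) (by positivity)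
  have hradius : c.radius ≤ R := by nlinarith [c.radius_le_diamRadius]
  have hyz : dist y z ≤ R * 2 ^ (-(j / Q y)) :=
    calc dist y z ≤ 2 * c.diamRadius * 2 ^ (-(j / Q x)) := by
          linarith [dist_triangle_left y z x]
      _ ≤ 2 * c.diamRadius * (c.scaleRatio * 2 ^ (-(j / Q y))) := by gcongr
      _ = R * 2 ^ (-(j / Q y)) := by ring
  have hfreeze : (2 : ℝ) ^ (j * gap Q p s y) ≤
      c.freezeConst c.diamRadius c.scaleRatio * 2 ^ (j * gap Q p s x) := by
    refine le_of_eq_of_le ?_ (hc.rpow_mul_two_rpow_le_freezeConst hR hW hxy (by positivity) hyx')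
    rw [← Real.rpow_mul two_pos.le, ← Real.rpow_add two_pos]
    unfold gap
    ring_nf
  have hx' := hE.abs_sub_le_two_rpow hc ht hη (hgap x) c.radius_le_diamRadius hj hjk hx hz hxz
  have hy' := hE.abs_sub_le_two_rpow hc ht hη (hgap y) hradius hj hjk hy hz hyz
  calc |v x - v y| ≤ |v x - v z| + |v y - v z| := by
        rw [abs_sub_comm (v y)]
        exact _root_.abs_sub_le _ _ _
    _ ≤ _ := add_le_add hx' hy'
    _ ≤ t * (c.stepConst c.diamRadius * (1 - 2 ^ (-η))⁻¹ * 2 ^ (j * gap Q p s x)) +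
        t * (c.stepConst R * (1 - 2 ^ (-η))⁻¹ *
          (c.freezeConst c.diamRadius c.scaleRatio * 2 ^ (j * gap Q p s x))) := by gcongr
    _ = _ := by ring

lemma abs_sub_le_dist_rpow (hE : LevelFamily c Q p s t v E) (hc : UniformExponents c Q p s)
    (ht : 0 ≤ t) (hη : 0 < η) (hgap : ∀ x, gap Q p s x ≤ -η) (hD : dist x y ≤ c.D)
    (hx : ∃ k, x ∈ E k) (hy : ∃ k, y ∈ E k) :
    |v x - v y| ≤ t * (c.holderConst η * dist x y ^ (s x - Q x / p x)) := by
  have hH := c.holderConst_pos hη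
  rcases eq_or_ne x y with rfl | hxy
  · rw [sub_self, abs_zero]
    positivity
  obtain ⟨j, hj, hdist, hscale⟩ := hc.exists_scale_dist hxy hD
  obtain ⟨k, hk⟩ := hx
  obtain ⟨l, hl⟩ := hy
  have hR := c.diamRadius_pos
  have hW := c.scaleRatio_pos
  have hpow := hc.two_rpow_mul_gap_le ((hgap x).trans (neg_nonpos.2 hη.le)) hscale
  refine (hE.abs_sub_le_two_rpow_of_dist_le hc ht hη hgap hj (k := max j (max k l)) (by lia)
    (hE.mono (by lia) hk) (hE.mono (by lia) hl) hdist).trans ?_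
  have hG := inv_pos.2 (one_sub_two_rpow_neg_pos hη)
  have := c.stepConst_pos hR
  have := c.stepConst_pos (R := 2 * c.diamRadius * c.scaleRatio) (by positivity)
  have := c.freezeConst_pos (R := c.diamRadius) hW
  unfold Params.holderConst
  rw [mul_assoc _ (2 ^ _)]
  gcongr

end LevelFamily

end Regimes

section Luxemburg

variable [MeasurableSpace X] {μ : Measure X} {p : X → ℝ} {f g : X → ℝ≥0∞} {t : ℝ}

/-- The positive real scales among which the Luxemburg norm of `f` is the infimum. -/
structure IsModularScale (μ : Measure X) (p : X → ℝ) (f : X → ℝ≥0∞) (t : ℝ) : Prop where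
  pos : 0 < t
  modular_le_one : modular μ p (fun x => f x / ENNReal.ofReal t) ≤ 1

lemma IsModularScale.luxNorm_le (ht : IsModularScale μ p f t) :
    luxNorm μ p f ≤ ENNReal.ofReal t :=
  sInf_le ⟨ENNReal.ofReal_pos.2 ht.pos, ENNReal.ofReal_lt_top, ht.modular_le_one⟩

lemma le_mul_luxNorm {a : ℝ≥0∞} {C : ℝ} (hC : 0 < C)
    (h : ∀ t, IsModularScale μ p f t → a ≤ ENNReal.ofReal (C * t)) :
    a ≤ ENNReal.ofReal C * luxNorm μ p f := by
  have hC0 : ENNReal.ofReal C ≠ 0 := (ENNReal.ofReal_pos.2 hC).ne'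
  rw [mul_comm, ← ENNReal.div_le_iff_le_mul (.inl hC0) (.inl ENNReal.ofReal_ne_top)]
  refine le_sInf fun t ⟨ht0, ht, hmod⟩ => ?_
  rw [ENNReal.div_le_iff_le_mul (.inl hC0) (.inl ENNReal.ofReal_ne_top), mul_comm]
  have hscale : IsModularScale μ p f t.toReal :=
    ⟨ENNReal.toReal_pos ht0.ne' ht.ne, by rwa [ENNReal.ofReal_toReal ht.ne]⟩
  simpa only [ENNReal.ofReal_mul hC.le, ENNReal.ofReal_toReal ht.ne] using h _ hscale

lemma le_mul_luxNorm_add {a : ℝ≥0∞} {C : ℝ} (hC : 0 < C)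
    (h : ∀ t t', IsModularScale μ p f t → IsModularScale μ p g t' →
      a ≤ ENNReal.ofReal (C * (t + t'))) :
    a ≤ ENNReal.ofReal C * (luxNorm μ p f + luxNorm μ p g) := by
  rw [mul_add, ← tsub_le_iff_right]
  refine le_mul_luxNorm hC fun t ht => ?_
  rw [tsub_le_iff_left, ← tsub_le_iff_right]
  refine le_mul_luxNorm hC fun t' ht' => ?_
  rw [tsub_le_iff_left, ← ENNReal.ofReal_add (mul_pos hC ht.pos).le (mul_pos hC ht'.pos).le,
    ← mul_add]
  exact h t t' ht ht'

lemma exists_isModularScale {l : ℝ} (hl : 0 < l) (hp : ∀ x, l ≤ p x)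
    (hf : modular μ p f < ∞) : ∃ t, IsModularScale μ p f t := by
  set I := modular μ p f
  set T := (1 + I) ^ (1 / l) with hT
  have hI : 1 + I ≠ ∞ := by finiteness
  have hTtop : T ≠ ∞ := ENNReal.rpow_ne_top_of_nonneg (by positivity) hI
  have hT1 : 1 ≤ T := ENNReal.one_le_rpow le_self_add (by positivity)
  refine ⟨T.toReal, ENNReal.toReal_pos (one_pos.trans_le hT1).ne' hTtop, ?_⟩
  rw [ENNReal.ofReal_toReal hTtop]
  have hTp : ∀ x, 1 + I ≤ T ^ p x := fun x =>
    calc 1 + I = T ^ l := by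
          rw [hT, ← ENNReal.rpow_mul, one_div_mul_cancel hl.ne', ENNReal.rpow_one]
      _ ≤ T ^ p x := ENNReal.rpow_le_rpow_of_exponent_le hT1 (hp x)
  calc modular μ p (fun x => f x / T) ≤ ∫⁻ x, (1 + I)⁻¹ * f x ^ p x ∂μ := by
        refine lintegral_mono fun x => ?_
        beta_reduce
        rw [ENNReal.div_rpow_of_nonneg _ _ (hl.le.trans (hp x)), mul_comm, ← div_eq_mul_inv]
        exact ENNReal.div_le_div_left (hTp x) _
    _ = (1 + I)⁻¹ * I := lintegral_const_mul' _ _ (by simp)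
    _ ≤ (1 + I)⁻¹ * (1 + I) := by gcongr; exact le_add_self
    _ = 1 := ENNReal.inv_mul_cancel (by positivity) hI

lemma luxNorm_lt_top {l : ℝ} (hl : 0 < l) (hp : ∀ x, l ≤ p x) (hf : modular μ p f < ∞) :
    luxNorm μ p f < ∞ :=
  let ⟨_, ht⟩ := exists_isModularScale hl hp hf
  ht.luxNorm_le.trans_lt ENNReal.ofReal_lt_top

lemma exists_isModularScale_le_two_mul (hpos : 0 < luxNorm μ p f) (hfin : luxNorm μ p f < ∞) :
    ∃ t, IsModularScale μ p f t ∧ t ≤ 2 * (luxNorm μ p f).toReal := by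
  have hlt : luxNorm μ p f < 2 * luxNorm μ p f := by
    rw [two_mul]
    exact ENNReal.lt_add_right hfin.ne hpos.ne'
  obtain ⟨t, ⟨ht0, ht, hmod⟩, htl⟩ := sInf_lt_iff.1 hlt
  refine ⟨t.toReal, ⟨ENNReal.toReal_pos ht0.ne' ht.ne, by rwa [ENNReal.ofReal_toReal ht.ne]⟩, ?_⟩
  simpa using ENNReal.toReal_mono (ENNReal.mul_ne_top ENNReal.ofNat_ne_top hfin.ne) htl.le

lemma luxNorm_of_isEmpty [IsEmpty X] (μ : Measure X) (p : X → ℝ) (f : X → ℝ≥0∞) :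
    luxNorm μ p f = 0 := by
  refine le_antisymm (ENNReal.le_of_forall_pos_le_add fun ε hε _ => ?_) zero_le
  rw [zero_add]
  exact sInf_le ⟨by simpa using hε, ENNReal.coe_lt_top,
    by simp [modular, Measure.eq_zero_of_isEmpty μ]⟩

lemma mul_rpow_div_rpow_inv_le {K h m θ θ₁ : ℝ} (hK : 0 < K) (hh : 0 ≤ h) (hm : 0 ≤ m)
    (hθ : 0 < θ) (hθ₁ : θ ≤ θ₁) :
    (K * (1 + h) ^ θ / (K * (1 + m) ^ θ₁)) ^ θ⁻¹ ≤ (1 + m)⁻¹ * (1 + h) :=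
  calc (K * (1 + h) ^ θ / (K * (1 + m) ^ θ₁)) ^ θ⁻¹
      ≤ (K * (1 + h) ^ θ / (K * (1 + m) ^ θ)) ^ θ⁻¹ := by
        gcongr
        linarith
    _ = (1 + m)⁻¹ * (1 + h) := by
        rw [mul_div_mul_left _ _ hK.ne', ← Real.div_rpow (by positivity) (by positivity),
          Real.rpow_rpow_inv (by positivity) hθ.ne', inv_mul_eq_div]

lemma luxNorm_inv_le_of_le_rpow [IsFiniteMeasure μ] {θ h : X → ℝ} {θ₁ K : ℝ}
    (hθ : ∀ x, 0 < θ x) (hθ₁ : ∀ x, θ x ≤ θ₁) (hK : 0 < K) (hh : ∀ x, 0 ≤ h x)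
    (hint : ∫⁻ x, ENNReal.ofReal (h x) ∂μ ≤ 1)
    (hf : ∀ᵐ x ∂μ, f x ≤ ENNReal.ofReal (K * (1 + h x) ^ θ x)) :
    luxNorm μ (fun x => (θ x)⁻¹) f ≤ ENNReal.ofReal (K * (1 + μ.real univ) ^ θ₁) := by
  set m := μ.real univ with hm
  have hm0 : 0 ≤ m := measureReal_nonneg
  have hT : 0 < K * (1 + m) ^ θ₁ := by positivity
  have hpoint : ∀ᵐ x ∂μ, (f x / ENNReal.ofReal (K * (1 + m) ^ θ₁)) ^ (θ x)⁻¹ ≤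
      ENNReal.ofReal (1 + m)⁻¹ * (1 + ENNReal.ofReal (h x)) := by
    filter_upwards [hf] with x hx
    have hhx := hh x
    have hθx := inv_pos.2 (hθ x)
    calc (f x / ENNReal.ofReal (K * (1 + m) ^ θ₁)) ^ (θ x)⁻¹
        ≤ (ENNReal.ofReal (K * (1 + h x) ^ θ x) /
            ENNReal.ofReal (K * (1 + m) ^ θ₁)) ^ (θ x)⁻¹ := by gcongr
      _ = ENNReal.ofReal ((K * (1 + h x) ^ θ x / (K * (1 + m) ^ θ₁)) ^ (θ x)⁻¹) := by
        rw [← ENNReal.ofReal_div_of_pos hT, ENNReal.ofReal_rpow_of_nonneg (by positivity) hθx.le]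
      _ ≤ ENNReal.ofReal ((1 + m)⁻¹ * (1 + h x)) :=
        ENNReal.ofReal_le_ofReal (mul_rpow_div_rpow_inv_le hK hhx hm0 (hθ x) (hθ₁ x))
      _ = _ := by
        rw [ENNReal.ofReal_mul (by positivity), ENNReal.ofReal_add zero_le_one hhx,
          ENNReal.ofReal_one]
  refine IsModularScale.luxNorm_le ⟨hT, ?_⟩
  calc modular μ (fun x => (θ x)⁻¹) (fun x => f x / ENNReal.ofReal (K * (1 + m) ^ θ₁))
      ≤ ∫⁻ x, ENNReal.ofReal (1 + m)⁻¹ * (1 + ENNReal.ofReal (h x)) ∂μ := lintegral_mono_ae hpoint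
    _ = ENNReal.ofReal (1 + m)⁻¹ * (μ univ + ∫⁻ x, ENNReal.ofReal (h x) ∂μ) := by
        rw [lintegral_const_mul' _ _ (by simp), lintegral_add_left measurable_const, lintegral_one]
    _ ≤ ENNReal.ofReal (1 + m)⁻¹ * ENNReal.ofReal (1 + m) := by
        gcongr
        rw [add_comm, ENNReal.ofReal_add zero_le_one hm0, ENNReal.ofReal_one, hm,
          ofReal_measureReal]
        gcongr
    _ = 1 := by
        rw [← ENNReal.ofReal_mul (by positivity), inv_mul_cancel₀ (by positivity),
          ENNReal.ofReal_one]

end Luxemburg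

section Energy

variable {p : X → ℝ} {g : X → ℝ≥0∞} {t : ℝ}

/-- The integrand of the modular of `g / t`, as a real number. It is `0` where `g = ∞`. -/
noncomputable def energy (p : X → ℝ) (g : X → ℝ≥0∞) (t : ℝ) (x : X) : ℝ :=
  (g x / ENNReal.ofReal t).toReal ^ p x

lemma energy_nonneg (p : X → ℝ) (g : X → ℝ≥0∞) (t : ℝ) (x : X) : 0 ≤ energy p g t x :=
  Real.rpow_nonneg ENNReal.toReal_nonneg _

lemma toReal_le_of_energy_le {x : X} {j : ℕ} (hp : 0 < p x) (ht : 0 < t)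
    (h : energy p g t x ≤ 2 ^ j) : (g x).toReal ≤ t * 2 ^ (j / p x) := by
  have hroot : (g x).toReal / t ≤ ((2 : ℝ) ^ j) ^ (p x)⁻¹ := by
    rw [Real.le_rpow_inv_iff_of_pos (by positivity) (by positivity) hp]
    rwa [energy, ENNReal.toReal_div, ENNReal.toReal_ofReal ht.le] at h
  rwa [← Real.rpow_natCast, ← Real.rpow_mul two_pos.le, ← div_eq_mul_inv, div_le_iff₀' ht]
    at hroot

variable [MeasurableSpace X] {μ : Measure X}

lemma measurable_energy (hp : Measurable p) (hg : Measurable g) (t : ℝ) :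
    Measurable (energy p g t) :=
  (hg.div_const _).ennreal_toReal.pow hp

lemma IsModularScale.lintegral_energy_le_one (hp : ∀ x, 0 < p x) (ht : IsModularScale μ p g t) :
    ∫⁻ x, ENNReal.ofReal (energy p g t x) ∂μ ≤ 1 := by
  refine (lintegral_mono fun x => ?_).trans ht.modular_le_one
  unfold energy
  rw [← ENNReal.ofReal_rpow_of_nonneg ENNReal.toReal_nonneg (hp x).le]
  exact ENNReal.rpow_le_rpow ENNReal.ofReal_toReal_le (hp x).le

lemma IsModularScale.integrable_energy (hpm : Measurable p) (hp : ∀ x, 0 < p x)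
    (hg : Measurable g) (ht : IsModularScale μ p g t) : Integrable (energy p g t) μ := by
  refine ⟨(measurable_energy hpm hg t).aestronglyMeasurable, ?_⟩
  rw [hasFiniteIntegral_iff_ofReal (.of_forall (energy_nonneg p g t))]
  exact (ht.lintegral_energy_le_one hp).trans_lt ENNReal.one_lt_top

lemma IsModularScale.integral_energy_le_one (hpm : Measurable p) (hp : ∀ x, 0 < p x)
    (hg : Measurable g) (ht : IsModularScale μ p g t) : ∫ x, energy p g t x ∂μ ≤ 1 := by
  rw [← ENNReal.ofReal_le_ofReal_iff zero_le_one, ofReal_integral_eq_lintegral_ofReal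
    (ht.integrable_energy hpm hp hg) (.of_forall (energy_nonneg p g t)), ENNReal.ofReal_one]
  exact ht.lintegral_energy_le_one hp

lemma IsModularScale.measure_lt_energy_le (hpm : Measurable p) (hp : ∀ x, 0 < p x)
    (hg : Measurable g) (ht : IsModularScale μ p g t) (j : ℕ) :
    μ {x | 2 ^ j < energy p g t x} ≤ ENNReal.ofReal (2 ^ (-(j : ℝ))) := by
  have hcheb := meas_ge_le_lintegral_div (μ := μ)
    (measurable_energy hpm hg t).ennreal_ofReal.aemeasurable
    (ε := ENNReal.ofReal (2 ^ j)) (by simp) ENNReal.ofReal_ne_top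
  refine (measure_mono fun x hx => ENNReal.ofReal_le_ofReal (le_of_lt hx)).trans
    (hcheb.trans ((ENNReal.div_le_div_right (ht.lintegral_energy_le_one hp) _).trans_eq ?_))
  rw [one_div, ← ENNReal.ofReal_inv_of_pos (by positivity), Real.rpow_neg two_pos.le,
    Real.rpow_natCast]

end Energy

section LevelSets

lemma absSub_eq_ofReal {u : X → EReal} {x : X} (hx : u x = ((u x).toReal : EReal)) (a : ℝ) :
    absSub u a x = ENNReal.ofReal |(u x).toReal - a| := by
  rw [absSub, hx, ← EReal.coe_sub, EReal.abs_def, EReal.toReal_coe]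

variable [MetricSpace X] [MeasurableSpace X] {μ : Measure X} {Q p s : X → ℝ} {u : X → EReal}
  {g : X → ℝ≥0∞} {N F : Set X} {t : ℝ} {c : Params} {j : ℕ}

lemma Setting.dist_le (h : Setting μ Q p s c.b c.δ c.D c.KQ c.Kp c.Ks) (x y : X) :
    dist x y ≤ c.D := by
  rw [← h.diam_eq]
  exact Metric.dist_le_diam_of_mem h.bounded (mem_univ x) (mem_univ y)

lemma Setting.isFiniteMeasure (h : Setting μ Q p s c.b c.δ c.D c.KQ c.Kp c.Ks) :
    IsFiniteMeasure μ where
  measure_univ_lt_top := by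
    rcases isEmpty_or_nonempty X with hX | ⟨⟨x⟩⟩
    · simp [Measure.eq_zero_of_isEmpty μ]
    obtain ⟨r, hr, hball⟩ := h.bounded.subset_ball_lt 0 x
    exact (measure_mono hball).trans_lt (h.metricMeasure x r hr).2

lemma Setting.uniformExponents (h : Setting μ Q p s c.b c.δ c.D c.KQ c.Kp c.Ks) :
    UniformExponents c Q p s :=
  have := h.metricMeasure.isOpenPosMeasure
  ⟨h.expQ.isUniformExponent, h.expP.isUniformExponent, h.expS.isUniformExponent⟩

/-- A null set off which `u` is finite and `g` obeys the scalar gradient inequality for `u`, written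
in real numbers. -/
structure IsExceptionalSet (μ : Measure X) (s : X → ℝ) (u : X → EReal) (g : X → ℝ≥0∞)
    (N : Set X) : Prop where
  measure_eq_zero : μ N = 0
  eq_coe : ∀ x ∉ N, u x = ((u x).toReal : EReal)
  abs_sub_le : ∀ x ∉ N, ∀ y ∉ N, |(u x).toReal - (u y).toReal| ≤
    dist x y ^ s x * (g x).toReal + dist x y ^ s y * (g y).toReal

lemma exists_isExceptionalSet (hp : Measurable p) (hp0 : ∀ x, 0 < p x)
    (hu : u ∈ HomSobolev μ s p) (hg : g ∈ ScalarGradients μ s u) (hgp : MemVarLp μ p g) :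
    ∃ N, IsExceptionalSet μ s u g N := by
  obtain ⟨-, hfin, -⟩ := hu
  obtain ⟨N₀, hN₀, hgrad⟩ := hg
  obtain ⟨hgmeas, hgmod⟩ := hgp
  have hgfin : ∀ᵐ x ∂μ, g x ≠ ∞ := by
    filter_upwards [ae_lt_top (hgmeas.pow hp) hgmod.ne] with x hx hgx
    rw [hgx, ENNReal.top_rpow_of_pos (hp0 x)] at hx
    exact hx.ne rfl
  have hgood : ∀ᵐ x ∂μ, x ∉ N₀ ∧ (u x ≠ ⊤ ∧ u x ≠ ⊥) ∧ g x ≠ ∞ :=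
    (measure_eq_zero_iff_ae_notMem.1 hN₀).and (hfin.and hgfin)
  have hcoe : ∀ x, u x ≠ ⊤ ∧ u x ≠ ⊥ → u x = ((u x).toReal : EReal) := fun x hx =>
    (EReal.coe_toReal hx.1 hx.2).symm
  refine ⟨_, ae_iff.1 hgood, fun x hx => hcoe x (not_not.1 hx).2.1, fun x hx y hy => ?_⟩
  obtain ⟨hxN, hux, hgx⟩ := not_not.1 hx
  obtain ⟨hyN, huy, hgy⟩ := not_not.1 hy
  have hxy := hgrad x hxN y hyN
  rwa [hcoe x hux, hcoe y huy, ← EReal.coe_sub, EReal.abs_def, ← ENNReal.ofReal_toReal hgx,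
    ← ENNReal.ofReal_toReal hgy, ← ENNReal.ofReal_mul (by positivity),
    ← ENNReal.ofReal_mul (by positivity), ← ENNReal.ofReal_add (by positivity) (by positivity),
    ENNReal.ofReal_le_ofReal_iff (by positivity)] at hxy

/-- The set `{g ≤ t * 2 ^ (j / p)} \ N`, where `N` is expected to contain all points at which
`g = ∞`. -/
def levelSet (p : X → ℝ) (g : X → ℝ≥0∞) (t : ℝ) (N : Set X) (j : ℕ) : Set X :=
  {x | x ∉ N ∧ energy p g t x ≤ 2 ^ j}

lemma LowerRegular.exists_mem_levelSet (hreg : LowerRegular μ Q c.b c.δ)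
    (hQ : IsUniformExponent c.KQ Q) (hpm : Measurable p) (hp : ∀ x, 0 < p x) (hg : Measurable g)
    (ht : IsModularScale μ p g t) (hN : μ N = 0) (hj : c.startScale ≤ j) (x : X)
    (hF : μ F ≤ ENNReal.ofReal (2 ^ (-(j : ℝ)))) :
    ∃ y ∈ levelSet p g t N j, y ∉ F ∧ dist x y ≤ c.radius * 2 ^ (-(j / Q x)) := by
  have hbad : μ (N ∪ {x | 2 ^ j < energy p g t x} ∪ F) ≤
      ENNReal.ofReal (2 * 2 ^ (-(j : ℝ))) := by
    rw [two_mul, ENNReal.ofReal_add (by positivity) (by positivity)]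
    refine (measure_union_le _ _).trans (add_le_add ?_ hF)
    refine (measure_union_le _ _).trans ?_
    rw [hN, zero_add]
    exact ht.measure_lt_energy_le hpm hp hg j
  obtain ⟨y, hy, hxy⟩ := hreg.exists_notMem_dist_le hQ hj x hbad
  simp only [mem_union, mem_ofPred_eq, not_or, not_lt] at hy
  exact ⟨y, hy.1, hy.2, hxy⟩

lemma IsExceptionalSet.levelFamily (hN : IsExceptionalSet μ s u g N)
    (hreg : LowerRegular μ Q c.b c.δ) (hQ : IsUniformExponent c.KQ Q) (hpm : Measurable p)
    (hp : ∀ x, 0 < p x) (hg : Measurable g) (ht : IsModularScale μ p g t) :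
    LevelFamily c Q p s t (fun x => (u x).toReal) (levelSet p g t N) where
  mono i j hij x hx := ⟨hx.1, hx.2.trans (pow_le_pow_right₀ one_le_two hij)⟩
  exists_near j hj x := by
    obtain ⟨y, hy, -, hxy⟩ := hreg.exists_mem_levelSet hQ hpm hp hg ht hN.measure_eq_zero hj x
      (F := ∅) (by simp)
    exact ⟨y, hy, hxy⟩
  gradient_bound j x hx y hy :=
    calc |(u x).toReal - (u y).toReal|
        ≤ dist x y ^ s x * (g x).toReal + dist x y ^ s y * (g y).toReal :=
          hN.abs_sub_le x hx.1 y hy.1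
      _ ≤ dist x y ^ s x * (t * 2 ^ (j / p x)) + dist x y ^ s y * (t * 2 ^ (j / p y)) := by
          gcongr
          · exact toReal_le_of_energy_le (hp x) ht.pos hx.2
          · exact toReal_le_of_energy_le (hp y) ht.pos hy.2
      _ = t * (dist x y ^ s x * 2 ^ (j / p x) + dist x y ^ s y * 2 ^ (j / p y)) := by ring

end LevelSets

section Averages

lemma one_add_log_le {h : ℝ} (hh : 0 ≤ h) : 1 + Real.log (1 + h) ≤ 1 + h := by
  linarith [Real.log_le_sub_one_of_pos (show 0 < 1 + h by linarith)]

variable [MeasurableSpace X] {μ : Measure X} [IsFiniteMeasure μ] {V F h : X → ℝ} {a K R : ℝ}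

lemma integrable_of_abs_sub_le (hV : AEStronglyMeasurable V μ) (hF : Integrable F μ)
    (h : ∀ᵐ x ∂μ, |V x - a| ≤ F x) : Integrable V μ := by
  have hsub : Integrable (fun x => V x - a) μ := hF.mono' (hV.sub aestronglyMeasurable_const) h
  exact (hsub.add (integrable_const a)).congr (.of_forall fun x => sub_add_cancel _ _)

variable [NeZero μ]

lemma abs_average_sub_le (hV : Integrable V μ) (hF : Integrable F μ)
    (h : ∀ᵐ x ∂μ, |V x - a| ≤ F x) : |(⨍ x, V x ∂μ) - a| ≤ ⨍ x, F x ∂μ := by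
  have hsub : (⨍ x, V x ∂μ) - a = ⨍ x, (V x - a) ∂μ := by
    conv_lhs => rw [← average_const μ a]
    simp only [average_eq, smul_eq_mul, ← mul_sub, integral_sub hV (integrable_const a)]
  rw [hsub, average_eq, average_eq, smul_eq_mul, smul_eq_mul, abs_mul,
    abs_of_nonneg (by positivity)]
  gcongr
  exact (Real.norm_eq_abs _).symm.trans_le (norm_integral_le_of_norm_le hF h)

lemma average_one_add_le (hh : Integrable h μ) (hR : ⨍ x, h x ∂μ ≤ R) :
    ⨍ x, (1 + h x) ∂μ ≤ 1 + R := by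
  have hadd : ⨍ x, (1 + h x) ∂μ = (⨍ _x, (1 : ℝ) ∂μ) + ⨍ x, h x ∂μ := by
    simp only [average_eq, smul_eq_mul, ← mul_add, integral_add (integrable_const 1) hh]
  rw [hadd, average_const]
  gcongr

lemma abs_sub_average_le_log (hV : AEStronglyMeasurable V μ) (hh : Integrable h μ)
    (hh0 : ∀ x, 0 ≤ h x) (hR : ⨍ x, h x ∂μ ≤ R) (hK : 0 ≤ K)
    (hlog : ∀ᵐ x ∂μ, |V x - a| ≤ K * (1 + Real.log (1 + h x))) :
    ∀ᵐ x ∂μ, |V x - ⨍ y, V y ∂μ| ≤ K * (2 + R) * (1 + Real.log (1 + h x)) := by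
  have hlin : ∀ᵐ x ∂μ, |V x - a| ≤ K * (1 + h x) := by
    filter_upwards [hlog] with x hx
    exact hx.trans (mul_le_mul_of_nonneg_left (one_add_log_le (hh0 x)) hK)
  have hint := ((integrable_const 1).add hh).const_mul K
  have hmean : |(⨍ y, V y ∂μ) - a| ≤ K * (1 + R) := by
    refine (abs_average_sub_le (integrable_of_abs_sub_le hV hint hlin) hint hlin).trans ?_
    rw [average_eq, smul_eq_mul, integral_const_mul, mul_left_comm, ← smul_eq_mul (_⁻¹),
      ← average_eq]
    exact mul_le_mul_of_nonneg_left (average_one_add_le hh hR) hK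
  filter_upwards [hlog] with x hx
  have hl : 0 ≤ Real.log (1 + h x) := Real.log_nonneg (by linarith [hh0 x])
  calc |V x - ⨍ y, V y ∂μ| ≤ |V x - a| + |(⨍ y, V y ∂μ) - a| := by
        rw [abs_sub_comm (⨍ y, V y ∂μ)]
        exact abs_sub_le _ _ _
    _ ≤ K * (1 + Real.log (1 + h x)) + K * (1 + R) * (1 + Real.log (1 + h x)) :=
        add_le_add hx (hmean.trans (le_mul_of_one_le_right ((abs_nonneg _).trans hmean)
          (le_add_of_nonneg_right hl)))
    _ = K * (2 + R) * (1 + Real.log (1 + h x)) := by ring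

lemma laverage_exp_le {φ : X → ℝ} (hh : Integrable h μ) (hh0 : ∀ x, 0 ≤ h x)
    (hR : ⨍ x, h x ∂μ ≤ R) (hφ : ∀ᵐ x ∂μ, φ x ≤ 1 + Real.log (1 + h x)) :
    ⨍⁻ x, ENNReal.ofReal (Real.exp (φ x)) ∂μ ≤ ENNReal.ofReal (Real.exp 1 * (1 + R)) := by
  have hexp : ∀ᵐ x ∂μ, ENNReal.ofReal (Real.exp (φ x)) ≤
      ENNReal.ofReal (Real.exp 1) * ENNReal.ofReal (1 + h x) := by
    filter_upwards [hφ] with x hx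
    have hpos : 0 < 1 + h x := by linarith [hh0 x]
    rw [← ENNReal.ofReal_mul (Real.exp_pos 1).le]
    refine ENNReal.ofReal_le_ofReal ((Real.exp_le_exp.2 hx).trans_eq ?_)
    rw [Real.exp_add, Real.exp_log hpos]
  have hint : Integrable (fun x => 1 + h x) μ := (integrable_const 1).add hh
  calc ⨍⁻ x, ENNReal.ofReal (Real.exp (φ x)) ∂μ
      ≤ ⨍⁻ x, ENNReal.ofReal (Real.exp 1) * ENNReal.ofReal (1 + h x) ∂μ := by
        simp only [laverage_eq]
        exact ENNReal.div_le_div_right (lintegral_mono_ae hexp) _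
    _ = ENNReal.ofReal (Real.exp 1) * ENNReal.ofReal (⨍ x, (1 + h x) ∂μ) := by
        rw [laverage_eq, lintegral_const_mul' _ _ ENNReal.ofReal_ne_top, mul_div_assoc,
          ofReal_average hint (.of_forall fun x => add_nonneg zero_le_one (hh0 x))]
    _ ≤ _ := by
        rw [ENNReal.ofReal_mul (Real.exp_pos 1).le]
        gcongr
        exact average_one_add_le hh hR

end Averages

section HolderExtension

variable [MetricSpace X] {E : Set X} {V v α : X → ℝ} {K α₀ : ℝ}

lemma uniformContinuous_of_abs_sub_le_dist_rpow (hα₀ : 0 < α₀) (hα : ∀ x, α₀ ≤ α x)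
    (hK : 0 ≤ K) (h : ∀ x y, |V x - V y| ≤ K * dist x y ^ α x) : UniformContinuous V := by
  rw [Metric.uniformContinuous_iff]
  intro ε hε
  have hK1 : 0 < ε / (K + 1) := by positivity
  refine ⟨min 1 ((ε / (K + 1)) ^ (1 / α₀)), by positivity, fun {x y} hxy => ?_⟩
  have hpow : dist x y ^ α x ≤ ε / (K + 1) := by
    rcases eq_or_lt_of_le (dist_nonneg (x := x) (y := y)) with h0 | hpos
    · rw [← h0, Real.zero_rpow (hα₀.trans_le (hα x)).ne']
      exact hK1.le
    calc dist x y ^ α x ≤ dist x y ^ α₀ :=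
          Real.rpow_le_rpow_of_exponent_ge hpos (hxy.le.trans (min_le_left _ _)) (hα x)
      _ ≤ ε / (K + 1) := by
          rw [← Real.le_rpow_inv_iff_of_pos hpos.le hK1.le hα₀, ← one_div]
          exact hxy.le.trans (min_le_right _ _)
  rw [Real.dist_eq]
  calc |V x - V y| ≤ K * (ε / (K + 1)) := (h x y).trans (by gcongr)
    _ < (K + 1) * (ε / (K + 1)) := by gcongr; linarith
    _ = ε := by field_simp

lemma exists_continuous_extension (hE : Dense E) (hα₀ : 0 < α₀) (hα : ∀ x, α₀ ≤ α x)
    (hK : 0 ≤ K) (h : ∀ x ∈ E, ∀ y ∈ E, |V x - V y| ≤ K * dist x y ^ α x) :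
    ∃ v : X → ℝ, Continuous v ∧ ∀ x ∈ E, v x = V x := by
  have hV : UniformContinuous fun x : E => V x :=
    uniformContinuous_of_abs_sub_le_dist_rpow hα₀ (fun x : E => hα x) hK
      fun x y => h x x.2 y y.2
  exact ⟨hE.extend fun x : E => V x, (hE.uniformContinuous_extend hV).continuous,
    fun x hx => hE.extend_eq hV.continuous ⟨x, hx⟩⟩

lemma abs_sub_le_dist_rpow_of_dense (hE : Dense E) (hv : Continuous v) (hα : Continuous α)
    (hα0 : ∀ x, 0 < α x) (h : ∀ x ∈ E, ∀ y ∈ E, |v x - v y| ≤ K * dist x y ^ α x) (x y : X) :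
    |v x - v y| ≤ K * dist x y ^ α x := by
  have hclosed : IsClosed {z : X × X | |v z.1 - v z.2| ≤ K * dist z.1 z.2 ^ α z.1} :=
    isClosed_le (by fun_prop) (continuous_const.mul
      (continuous_dist.rpow (hα.comp continuous_fst) fun z => .inr (hα0 _)))
  have hsub := hclosed.closure_subset_iff.2 fun z (hz : z ∈ E ×ˢ E) => h z.1 hz.1 z.2 hz.2
  rw [(hE.prod hE).closure_eq] at hsub
  exact hsub (mem_univ (x, y))

end HolderExtension

section Gap

variable {Q p s : X → ℝ} {x : X} {c : Params} {ε : ℝ}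

lemma gap_eq_div (hQ : 0 < Q x) (hp : 0 < p x) :
    gap Q p s x = (Q x - s x * p x) / (Q x * p x) := by
  unfold gap
  field_simp

lemma inv_gap (hQ : ∀ x, 0 < Q x) (hp : ∀ x, 0 < p x) :
    (fun x => (gap Q p s x)⁻¹) = fun x => Q x * p x / (Q x - s x * p x) :=
  funext fun x => by rw [gap_eq_div (hQ x) (hp x), inv_div]

lemma gap_eq_zero (hQ : 0 < Q x) (hp : 0 < p x) (h : s x * p x = Q x) : gap Q p s x = 0 := by
  rw [gap_eq_div hQ hp, h, sub_self, zero_div]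

/-- A lower bound for `|gap|` where `|Q - s p| ≥ ε`. The maximum keeps it positive for every choice
of `c`, including those which no exponents satisfy. -/
noncomputable def Params.gapBound (c : Params) (ε : ℝ) : ℝ :=
  ε / max 1 (c.KQ.upper * c.Kp.upper)

lemma Params.gapBound_pos (c : Params) (hε : 0 < ε) : 0 < c.gapBound ε :=
  div_pos hε (one_pos.trans_le (le_max_left _ _))

namespace UniformExponents

variable [MetricSpace X]

lemma gapBound_le_div (hc : UniformExponents c Q p s) (hε : 0 < ε) {a : ℝ} (ha : ε ≤ a) :
    c.gapBound ε ≤ a / (Q x * p x) := by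
  have hQ := hc.expQ.pos x
  have hp := hc.expP.pos x
  refine div_le_div₀ (hε.le.trans ha) ha (by positivity) ((le_max_right 1 _).trans' ?_)
  exact mul_le_mul (hc.expQ.le_upper x) (hc.expP.le_upper x) hp.le (hc.expQ.upper_pos x).le

lemma gapBound_le_gap (hc : UniformExponents c Q p s) (hε : 0 < ε) (h : ε ≤ Q x - s x * p x) :
    c.gapBound ε ≤ gap Q p s x := by
  rw [gap_eq_div (hc.expQ.pos x) (hc.expP.pos x)]
  exact hc.gapBound_le_div hε h

lemma gap_le_neg_gapBound (hc : UniformExponents c Q p s) (hε : 0 < ε)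
    (h : ε ≤ s x * p x - Q x) : gap Q p s x ≤ -c.gapBound ε := by
  rw [gap_eq_div (hc.expQ.pos x) (hc.expP.pos x), ← neg_sub (s x * p x), neg_div]
  exact neg_le_neg (hc.gapBound_le_div hε h)

lemma mul_le_sub_div (hc : UniformExponents c Q p s) {η : ℝ} (hη : 0 < η)
    (hgap : gap Q p s x ≤ -η) : c.KQ.lower * η ≤ s x - Q x / p x := by
  rw [hc.sub_div_eq_neg_mul_gap, ← mul_neg]
  exact mul_le_mul (hc.expQ.lower_le x) (le_neg_of_le_neg hgap) hη.le (hc.expQ.pos x).le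

end UniformExponents

end Gap

/-- The constant of the Sobolev inequalities, if `μ univ = m` and `gap ≥ η`. The power of `2`
bounds `|u| / t` at a point where the energy of `u` at scale `t` is at most `2 ^ c.startScale`. -/
noncomputable def Params.sobolevConst (c : Params) (m η : ℝ) : ℝ :=
  (c.growthConst η + 2 ^ (c.startScale / c.Kp.lower)) * (1 + m) ^ (1 / c.Kp.lower)

lemma Params.sobolevConst_pos (c : Params) {m η : ℝ} (hm : 0 ≤ m) (hη : 0 < η) :
    0 < c.sobolevConst m η := by
  have := c.growthConst_pos hη
  unfold sobolevConst
  positivity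

/-- The constant of the logarithmic estimate for `|u - mean μ u|` if `gap = 0`. The power of `2`
bounds the average of the energy of a scalar gradient. -/
noncomputable def Params.logConst (c : Params) : ℝ :=
  2 * c.stepConst c.diamRadius * (2 + 2 ^ c.startScale)

lemma Params.logConst_pos (c : Params) : 0 < c.logConst := by
  have := c.stepConst_pos c.diamRadius_pos
  unfold logConst
  positivity

/-- The constant of the bound for `|u - mean μ u|` if `gap ≤ -η`. -/
noncomputable def Params.supConst (c : Params) (η : ℝ) : ℝ :=
  c.holderConst η * max 1 c.D ^ c.Ks.upper

lemma Params.supConst_pos (c : Params) {η : ℝ} (hη : 0 < η) : 0 < c.supConst η := by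
  have := c.holderConst_pos hη
  unfold supConst
  positivity

namespace Setting

variable [MetricSpace X] [MeasurableSpace X] {μ : Measure X} {Q p s : X → ℝ} {u : X → EReal}
  {g : X → ℝ≥0∞} {N : Set X} {t η ε : ℝ} {c : Params}

lemma gapBound_le_gap (h : Setting μ Q p s c.b c.δ c.D c.KQ c.Kp c.Ks) (hε : 0 < ε)
    (hsub : ∀ᵐ x ∂μ, ε ≤ Q x - s x * p x) (x : X) : c.gapBound ε ≤ gap Q p s x := by
  have hc := h.uniformExponents
  have := h.metricMeasure.isOpenPosMeasure
  exact hc.gapBound_le_gap hε (forall_le_of_ae_le continuous_const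
    (hc.expQ.continuous.sub (hc.expS.continuous.mul hc.expP.continuous)) hsub x)

lemma gap_le_neg_gapBound (h : Setting μ Q p s c.b c.δ c.D c.KQ c.Kp c.Ks) (hε : 0 < ε)
    (hsuper : ∀ᵐ x ∂μ, ε ≤ s x * p x - Q x) (x : X) : gap Q p s x ≤ -c.gapBound ε := by
  have hc := h.uniformExponents
  have := h.metricMeasure.isOpenPosMeasure
  exact hc.gap_le_neg_gapBound hε (forall_le_of_ae_le continuous_const
    ((hc.expS.continuous.mul hc.expP.continuous).sub hc.expQ.continuous) hsuper x)

lemma levelFamily (h : Setting μ Q p s c.b c.δ c.D c.KQ c.Kp c.Ks)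
    (hN : IsExceptionalSet μ s u g N) (hg : Measurable g) (ht : IsModularScale μ p g t) :
    LevelFamily c Q p s t (fun x => (u x).toReal) (levelSet p g t N) :=
  hN.levelFamily h.lowerRegular h.uniformExponents.expQ h.expP.measurable h.expP.pos hg ht

lemma exists_mem_levelSet [Nonempty X] (h : Setting μ Q p s c.b c.δ c.D c.KQ c.Kp c.Ks)
    {F : Set X} (hN : μ N = 0) (hg : Measurable g) (ht : IsModularScale μ p g t)
    (hF : μ F ≤ ENNReal.ofReal (2 ^ (-(c.startScale : ℝ)))) :
    ∃ z ∈ levelSet p g t N c.startScale, z ∉ F := by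
  obtain ⟨z, hz, hzF, -⟩ := h.lowerRegular.exists_mem_levelSet h.uniformExponents.expQ
    h.expP.measurable h.expP.pos hg ht hN le_rfl (Classical.arbitrary X) hF
  exact ⟨z, hz, hzF⟩

lemma luxNorm_absSub_le (h : Setting μ Q p s c.b c.δ c.D c.KQ c.Kp c.Ks) (hη : 0 < η)
    (hgap : ∀ x, η ≤ gap Q p s x) (hN : IsExceptionalSet μ s u g N) (hg : Measurable g)
    (ht : IsModularScale μ p g t) {z : X} (hz : z ∈ levelSet p g t N c.startScale) {a B : ℝ}
    (hB : |(u z).toReal - a| ≤ B) :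
    luxNorm μ (fun x => (gap Q p s x)⁻¹) (absSub u a) ≤
      ENNReal.ofReal ((t * c.growthConst η + B) * (1 + μ.real univ) ^ (1 / c.Kp.lower)) := by
  have hc := h.uniformExponents
  have := h.isFiniteMeasure
  have htG : 0 < t * c.growthConst η := mul_pos ht.pos (c.growthConst_pos hη)
  have hB0 : 0 ≤ B := (abs_nonneg _).trans hB
  refine luxNorm_inv_le_of_le_rpow (h := energy p g t) (fun x => hη.trans_le (hgap x)) hc.gap_le
    (by positivity) (energy_nonneg p g t) (ht.lintegral_energy_le_one h.expP.pos) ?_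
  filter_upwards [measure_eq_zero_iff_ae_notMem.1 hN.measure_eq_zero] with x hx
  rw [absSub_eq_ofReal (hN.eq_coe x hx)]
  refine ENNReal.ofReal_le_ofReal ?_
  have hgrowth : |(u x).toReal - (u z).toReal| ≤
      t * (c.growthConst η * (1 + energy p g t x) ^ gap Q p s x) :=
    (h.levelFamily hN hg ht).abs_sub_le_rpow_gap hc ht.pos.le (h.dist_le x z) hz hη (hgap x)
      (energy_nonneg p g t x) fun k hk => ⟨hx, hk⟩
  have hone : 1 ≤ (1 + energy p g t x) ^ gap Q p s x :=
    Real.one_le_rpow (le_add_of_nonneg_right (energy_nonneg p g t x)) (hη.le.trans (hgap x))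
  calc |(u x).toReal - a| ≤ |(u x).toReal - (u z).toReal| + |(u z).toReal - a| :=
        abs_sub_le _ _ _
    _ ≤ t * (c.growthConst η * (1 + energy p g t x) ^ gap Q p s x) +
          B * (1 + energy p g t x) ^ gap Q p s x :=
        add_le_add hgrowth (hB.trans (le_mul_of_one_le_right hB0 hone))
    _ = _ := by ring

theorem iInf_luxNorm_absSub_le (h : Setting μ Q p s c.b c.δ c.D c.KQ c.Kp c.Ks) (hη : 0 < η)
    (hgap : ∀ x, η ≤ gap Q p s x) (hu : u ∈ HomSobolev μ s p) (hg : g ∈ ScalarGradients μ s u)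
    (hgp : MemVarLp μ p g) :
    ⨅ a : ℝ, luxNorm μ (fun x => (gap Q p s x)⁻¹) (absSub u a) ≤
      ENNReal.ofReal (c.sobolevConst (μ.real univ) η) * luxNorm μ p g := by
  rcases isEmpty_or_nonempty X with hX | hX
  · simp only [luxNorm_of_isEmpty, ciInf_const, zero_le]
  obtain ⟨N, hN⟩ := exists_isExceptionalSet h.expP.measurable h.expP.pos hu hg hgp
  refine le_mul_luxNorm (c.sobolevConst_pos measureReal_nonneg hη) fun t ht => ?_
  obtain ⟨z, hz, -⟩ := h.exists_mem_levelSet (F := ∅) hN.measure_eq_zero hgp.1 ht (by simp)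
  have hself : |(u z).toReal - (u z).toReal| ≤ 0 := by rw [sub_self, abs_zero]
  refine (iInf_le _ (u z).toReal).trans <|
    (h.luxNorm_absSub_le hη hgap hN hgp.1 ht hz hself).trans (ENNReal.ofReal_le_ofReal ?_)
  have := ht.pos
  rw [add_zero, Params.sobolevConst, mul_right_comm _ _ t, mul_comm t]
  gcongr
  exact le_add_of_nonneg_right (by positivity)

theorem luxNorm_abs_le (h : Setting μ Q p s c.b c.δ c.D c.KQ c.Kp c.Ks) (hη : 0 < η)
    (hgap : ∀ x, η ≤ gap Q p s x) (hu : u ∈ Sobolev μ s p) (hg : g ∈ ScalarGradients μ s u)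
    (hgp : MemVarLp μ p g) :
    luxNorm μ (fun x => (gap Q p s x)⁻¹) (fun x => (u x).abs) ≤
      ENNReal.ofReal (c.sobolevConst (μ.real univ) η) *
        (luxNorm μ p (fun x => (u x).abs) + luxNorm μ p g) := by
  rcases isEmpty_or_nonempty X with hX | hX
  · simp only [luxNorm_of_isEmpty, zero_le]
  obtain ⟨N, hN⟩ := exists_isExceptionalSet h.expP.measurable h.expP.pos hu.1 hg hgp
  refine le_mul_luxNorm_add (c.sobolevConst_pos measureReal_nonneg hη) fun τ t hτ ht => ?_
  obtain ⟨z, hz, hzu⟩ := h.exists_mem_levelSet hN.measure_eq_zero hgp.1 ht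
    (hτ.measure_lt_energy_le h.expP.measurable h.expP.pos hu.2.1 c.startScale)
  have huz : |(u z).toReal - 0| ≤ τ * 2 ^ (c.startScale / c.Kp.lower) := by
    have hle := toReal_le_of_energy_le (h.expP.pos z) hτ.pos (not_lt.1 hzu)
    rw [hN.eq_coe z hz.1, EReal.abs_def, ENNReal.toReal_ofReal (abs_nonneg _)] at hle
    rw [sub_zero]
    refine hle.trans (mul_le_mul_of_nonneg_left ?_ hτ.pos.le)
    exact Real.rpow_le_rpow_of_exponent_le one_le_two (div_le_div_of_nonneg_left
      (Nat.cast_nonneg _) h.expP.lower_pos (h.uniformExponents.expP.lower_le z))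
  have habs : absSub u 0 = fun x => (u x).abs := funext fun x => by simp [absSub]
  rw [← habs]
  refine (h.luxNorm_absSub_le hη hgap hN hgp.1 ht hz huz).trans (ENNReal.ofReal_le_ofReal ?_)
  have := ht.pos
  have := hτ.pos
  have := c.growthConst_pos hη
  rw [Params.sobolevConst, mul_right_comm]
  gcongr
  have : 0 ≤ τ * c.growthConst η + t * 2 ^ (c.startScale / c.Kp.lower) := by positivity
  linarith

lemma measure_univ_ge [Nonempty X] (h : Setting μ Q p s c.b c.δ c.D c.KQ c.Kp c.Ks) :
    ENNReal.ofReal (2 ^ (-(c.startScale : ℝ))) ≤ μ univ := by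
  by_contra! hlt
  have hF : μ univ ≤ ENNReal.ofReal (2 * 2 ^ (-(c.startScale : ℝ))) :=
    hlt.le.trans (ENNReal.ofReal_le_ofReal (le_mul_of_one_le_left (by positivity) one_le_two))
  obtain ⟨y, hy, -⟩ := h.lowerRegular.exists_notMem_dist_le h.uniformExponents.expQ le_rfl
    (Classical.arbitrary X) hF
  exact hy (mem_univ y)

lemma neZero [Nonempty X] (h : Setting μ Q p s c.b c.δ c.D c.KQ c.Kp c.Ks) : NeZero μ :=
  ⟨fun hzero => by
    have hpos := (ENNReal.ofReal_pos.2 (by positivity)).trans_le h.measure_univ_ge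
    simp [hzero] at hpos⟩

lemma average_energy_le [Nonempty X] (h : Setting μ Q p s c.b c.δ c.D c.KQ c.Kp c.Ks)
    (hg : Measurable g) (ht : IsModularScale μ p g t) :
    ⨍ x, energy p g t x ∂μ ≤ 2 ^ c.startScale := by
  have := h.isFiniteMeasure
  have hμ : (2 ^ c.startScale : ℝ)⁻¹ ≤ μ.real univ := by
    rw [← Real.rpow_natCast, ← Real.rpow_neg two_pos.le]
    exact (ENNReal.ofReal_le_iff_le_toReal (measure_ne_top μ _)).1 h.measure_univ_ge
  rw [average_eq, smul_eq_mul]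
  calc (μ.real univ)⁻¹ * ∫ x, energy p g t x ∂μ ≤ 2 ^ c.startScale * 1 := by
        gcongr
        · exact integral_nonneg (energy_nonneg p g t)
        · exact inv_le_of_inv_le₀ (by positivity) hμ
        · exact ht.integral_energy_le_one h.expP.measurable h.expP.pos hg
    _ = 2 ^ c.startScale := mul_one _

lemma exists_ae_abs_sub_le_log [Nonempty X] (h : Setting μ Q p s c.b c.δ c.D c.KQ c.Kp c.Ks)
    (hgap : ∀ x, gap Q p s x = 0) (hN : IsExceptionalSet μ s u g N) (hg : Measurable g)
    (ht : IsModularScale μ p g t) :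
    ∃ a, ∀ᵐ x ∂μ, |(u x).toReal - a| ≤
      t * (2 * c.stepConst c.diamRadius) * (1 + Real.log (1 + energy p g t x)) := by
  obtain ⟨z, hz, -⟩ := h.exists_mem_levelSet (F := ∅) hN.measure_eq_zero hg ht (by simp)
  refine ⟨(u z).toReal, ?_⟩
  filter_upwards [measure_eq_zero_iff_ae_notMem.1 hN.measure_eq_zero] with x hx
  rw [mul_assoc]
  exact (h.levelFamily hN hg ht).abs_sub_le_log h.uniformExponents ht.pos.le (h.dist_le x z) hz
    (hgap x) (energy_nonneg p g t x) fun k hk => ⟨hx, hk⟩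

theorem integrable_of_gap_eq_zero (h : Setting μ Q p s c.b c.δ c.D c.KQ c.Kp c.Ks)
    (hgap : ∀ x, gap Q p s x = 0) (hu : u ∈ HomSobolev μ s p) (hg : g ∈ ScalarGradients μ s u)
    (hgp : MemVarLp μ p g) : Integrable (fun x => (u x).toReal) μ := by
  rcases isEmpty_or_nonempty X with hX | hX
  · simp only [Measure.eq_zero_of_isEmpty μ, integrable_zero_measure]
  have := h.isFiniteMeasure
  have hstep := c.stepConst_pos c.diamRadius_pos
  obtain ⟨N, hN⟩ := exists_isExceptionalSet h.expP.measurable h.expP.pos hu hg hgp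
  obtain ⟨t, ht⟩ := exists_isModularScale h.expP.lower_pos h.uniformExponents.expP.lower_le hgp.2
  obtain ⟨a, ha⟩ := h.exists_ae_abs_sub_le_log hgap hN hgp.1 ht
  have hint : Integrable (fun x => 1 + energy p g t x) μ :=
    (integrable_const 1).add (ht.integrable_energy h.expP.measurable h.expP.pos hgp.1)
  refine integrable_of_abs_sub_le hu.1.ereal_toReal.aestronglyMeasurable
    (hint.const_mul (t * (2 * c.stepConst c.diamRadius))) (a := a) ?_
  filter_upwards [ha] with x hx
  have := ht.pos
  exact hx.trans (mul_le_mul_of_nonneg_left (one_add_log_le (energy_nonneg p g t x))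
    (by positivity))

lemma ae_abs_sub_mean_le_log [Nonempty X] (h : Setting μ Q p s c.b c.δ c.D c.KQ c.Kp c.Ks)
    (hgap : ∀ x, gap Q p s x = 0) (hu : Measurable u) (hN : IsExceptionalSet μ s u g N)
    (hg : Measurable g) (ht : IsModularScale μ p g t) :
    ∀ᵐ x ∂μ, |(u x).toReal - mean μ u| ≤
      t * c.logConst * (1 + Real.log (1 + energy p g t x)) := by
  have := h.isFiniteMeasure
  have := h.neZero
  have hstep := c.stepConst_pos c.diamRadius_pos
  obtain ⟨a, ha⟩ := h.exists_ae_abs_sub_le_log hgap hN hg ht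
  rw [Params.logConst, ← mul_assoc]
  exact abs_sub_average_le_log hu.ereal_toReal.aestronglyMeasurable
    (ht.integrable_energy h.expP.measurable h.expP.pos hg) (energy_nonneg p g t)
    (h.average_energy_le hg ht) (mul_pos ht.pos (by positivity)).le ha

theorem laverage_exp_abs_sub_mean_le (h : Setting μ Q p s c.b c.δ c.D c.KQ c.Kp c.Ks)
    (hgap : ∀ x, gap Q p s x = 0) (hu : u ∈ HomSobolev μ s p) (hg : g ∈ ScalarGradients μ s u)
    (hgp : MemVarLp μ p g) (hpos : 0 < luxNorm μ p g) :
    ⨍⁻ x, ENNReal.ofReal (Real.exp ((2 * c.logConst)⁻¹ *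
      (|(u x).toReal - mean μ u| / (luxNorm μ p g).toReal))) ∂μ ≤
        ENNReal.ofReal (Real.exp 1 * (1 + 2 ^ c.startScale)) := by
  rcases isEmpty_or_nonempty X with hX | hX
  · simp only [Measure.eq_zero_of_isEmpty μ, laverage_zero_measure, zero_le]
  have := h.isFiniteMeasure
  have := h.neZero
  have hK := c.logConst_pos
  have hfin := luxNorm_lt_top h.expP.lower_pos h.uniformExponents.expP.lower_le hgp.2
  have hnorm := ENNReal.toReal_pos hpos.ne' hfin.ne
  obtain ⟨N, hN⟩ := exists_isExceptionalSet h.expP.measurable h.expP.pos hu hg hgp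
  obtain ⟨t, ht, htg⟩ := exists_isModularScale_le_two_mul hpos hfin
  refine laverage_exp_le (ht.integrable_energy h.expP.measurable h.expP.pos hgp.1)
    (energy_nonneg p g t) (h.average_energy_le hgp.1 ht) ?_
  filter_upwards [h.ae_abs_sub_mean_le_log hgap hu.1 hN hgp.1 ht] with x hx
  have hlog : 0 ≤ Real.log (1 + energy p g t x) :=
    Real.log_nonneg (le_add_of_nonneg_right (energy_nonneg p g t x))
  rw [inv_mul_eq_div, div_div, div_le_iff₀ (by positivity)]
  calc |(u x).toReal - mean μ u| ≤ t * c.logConst * (1 + Real.log (1 + energy p g t x)) := hx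
    _ ≤ 2 * (luxNorm μ p g).toReal * c.logConst * (1 + Real.log (1 + energy p g t x)) := by gcongr
    _ = _ := by ring

lemma abs_sub_le_dist_rpow (h : Setting μ Q p s c.b c.δ c.D c.KQ c.Kp c.Ks) (hη : 0 < η)
    (hgap : ∀ x, gap Q p s x ≤ -η) (hN : IsExceptionalSet μ s u g N) (hg : Measurable g)
    (ht : IsModularScale μ p g t) {x y : X} (hx : x ∉ N) (hy : y ∉ N) :
    |(u x).toReal - (u y).toReal| ≤ c.holderConst η * t * dist x y ^ (s x - Q x / p x) := by
  have hmem : ∀ z ∉ N, ∃ k, z ∈ levelSet p g t N k := fun z hz =>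
    (pow_unbounded_of_one_lt (energy p g t z) one_lt_two).imp fun k hk => ⟨hz, hk.le⟩
  refine ((h.levelFamily hN hg ht).abs_sub_le_dist_rpow h.uniformExponents ht.pos.le hη hgap
    (h.dist_le x y) (hmem x hx) (hmem y hy)).trans_eq ?_
  ring

lemma abs_sub_le_supConst (h : Setting μ Q p s c.b c.δ c.D c.KQ c.Kp c.Ks) (hη : 0 < η)
    (hgap : ∀ x, gap Q p s x ≤ -η) (hN : IsExceptionalSet μ s u g N) (hg : Measurable g)
    (ht : IsModularScale μ p g t) {x y : X} (hx : x ∉ N) (hy : y ∉ N) :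
    |(u x).toReal - (u y).toReal| ≤ c.supConst η * t := by
  have hc := h.uniformExponents
  have hα : 0 ≤ s x - Q x / p x :=
    (mul_pos h.expQ.lower_pos hη).le.trans (hc.mul_le_sub_div hη (hgap x))
  have hdist : dist x y ^ (s x - Q x / p x) ≤ max 1 c.D ^ c.Ks.upper :=
    (Real.rpow_le_rpow dist_nonneg ((h.dist_le x y).trans (le_max_right _ _)) hα).trans
      (Real.rpow_le_rpow_of_exponent_le (le_max_left _ _) (hc.sub_div_le_upper x))
  have := ht.pos
  have := c.holderConst_pos hη
  rw [Params.supConst, mul_right_comm]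
  exact (h.abs_sub_le_dist_rpow hη hgap hN hg ht hx hy).trans (by gcongr)

theorem integrable_of_gap_le_neg (h : Setting μ Q p s c.b c.δ c.D c.KQ c.Kp c.Ks) (hη : 0 < η)
    (hgap : ∀ x, gap Q p s x ≤ -η) (hu : u ∈ HomSobolev μ s p) (hg : g ∈ ScalarGradients μ s u)
    (hgp : MemVarLp μ p g) : Integrable (fun x => (u x).toReal) μ := by
  rcases isEmpty_or_nonempty X with hX | hX
  · simp only [Measure.eq_zero_of_isEmpty μ, integrable_zero_measure]
  have := h.isFiniteMeasure
  obtain ⟨N, hN⟩ := exists_isExceptionalSet h.expP.measurable h.expP.pos hu hg hgp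
  obtain ⟨t, ht⟩ := exists_isModularScale h.expP.lower_pos h.uniformExponents.expP.lower_le hgp.2
  obtain ⟨z, hz, -⟩ := h.exists_mem_levelSet (F := ∅) hN.measure_eq_zero hgp.1 ht (by simp)
  refine integrable_of_abs_sub_le hu.1.ereal_toReal.aestronglyMeasurable
    (integrable_const (c.supConst η * t)) (a := (u z).toReal) ?_
  filter_upwards [measure_eq_zero_iff_ae_notMem.1 hN.measure_eq_zero] with x hx
  exact h.abs_sub_le_supConst hη hgap hN hgp.1 ht hx hz.1

theorem essSup_absSub_mean_le (h : Setting μ Q p s c.b c.δ c.D c.KQ c.Kp c.Ks) (hη : 0 < η)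
    (hgap : ∀ x, gap Q p s x ≤ -η) (hu : u ∈ HomSobolev μ s p) (hg : g ∈ ScalarGradients μ s u)
    (hgp : MemVarLp μ p g) :
    essSup (absSub u (mean μ u)) μ ≤ ENNReal.ofReal (c.supConst η) * luxNorm μ p g := by
  rcases isEmpty_or_nonempty X with hX | hX
  · simp [Measure.eq_zero_of_isEmpty μ]
  have := h.isFiniteMeasure
  have := h.neZero
  obtain ⟨N, hN⟩ := exists_isExceptionalSet h.expP.measurable h.expP.pos hu hg hgp
  have hint := h.integrable_of_gap_le_neg hη hgap hu hg hgp
  have hNae := measure_eq_zero_iff_ae_notMem.1 hN.measure_eq_zero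
  refine le_mul_luxNorm (c.supConst_pos hη) fun t ht => essSup_le_of_ae_le _ ?_
  filter_upwards [hNae] with x hx
  rw [absSub_eq_ofReal (hN.eq_coe x hx), abs_sub_comm]
  refine ENNReal.ofReal_le_ofReal ?_
  refine (abs_average_sub_le hint (integrable_const (c.supConst η * t)) ?_).trans_eq
    (average_const μ _)
  filter_upwards [hNae] with y hy using h.abs_sub_le_supConst hη hgap hN hgp.1 ht hy hx

theorem exists_continuous_ae_eq (h : Setting μ Q p s c.b c.δ c.D c.KQ c.Kp c.Ks) (hη : 0 < η)
    (hgap : ∀ x, gap Q p s x ≤ -η) (hu : u ∈ HomSobolev μ s p) (hg : g ∈ ScalarGradients μ s u)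
    (hgp : MemVarLp μ p g) :
    ∃ v : X → ℝ, Continuous v ∧ (∀ᵐ x ∂μ, u x = (v x : EReal)) ∧
      ∀ x y, ENNReal.ofReal |v x - v y| ≤ ENNReal.ofReal (c.holderConst η) * luxNorm μ p g *
        ENNReal.ofReal (dist x y ^ (s x - Q x / p x)) := by
  have hc := h.uniformExponents
  have := h.metricMeasure.isOpenPosMeasure
  have hH := c.holderConst_pos hη
  obtain ⟨N, hN⟩ := exists_isExceptionalSet h.expP.measurable h.expP.pos hu hg hgp
  have hNae := measure_eq_zero_iff_ae_notMem.1 hN.measure_eq_zero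
  have hdense : Dense Nᶜ := Measure.dense_of_ae hNae
  have hα₀ : 0 < c.KQ.lower * η := mul_pos h.expQ.lower_pos hη
  have hα : ∀ x, c.KQ.lower * η ≤ s x - Q x / p x := fun x => hc.mul_le_sub_div hη (hgap x)
  have hαcont : Continuous fun x => s x - Q x / p x :=
    hc.expS.continuous.sub (hc.expQ.continuous.div hc.expP.continuous fun x => (h.expP.pos x).ne')
  obtain ⟨t₀, ht₀⟩ := exists_isModularScale h.expP.lower_pos hc.expP.lower_le hgp.2
  obtain ⟨v, hv, hvu⟩ := exists_continuous_extension hdense hα₀ hα (mul_pos hH ht₀.pos).le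
    fun x hx y hy => h.abs_sub_le_dist_rpow hη hgap hN hgp.1 ht₀ hx hy
  refine ⟨v, hv, ?_, fun x y => ?_⟩
  · filter_upwards [hNae] with x hx
    rw [hvu x hx]
    exact hN.eq_coe x hx
  rcases eq_or_ne x y with rfl | hxy
  · simp
  have hd := Real.rpow_pos_of_pos (dist_pos.2 hxy) (s x - Q x / p x)
  rw [mul_right_comm, ← ENNReal.ofReal_mul hH.le]
  refine le_mul_luxNorm (mul_pos hH hd) fun t ht => ENNReal.ofReal_le_ofReal ?_
  rw [mul_right_comm]
  refine abs_sub_le_dist_rpow_of_dense hdense hv hαcont (fun z => hα₀.trans_le (hα z))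
    (fun z hz w hw => ?_) x y
  rw [hvu z hz, hvu w hw]
  exact h.abs_sub_le_dist_rpow hη hgap hN hgp.1 ht hz hw

end Setting

end VarExp

theorem mainTheorem9 (b δ D : ℝ) (hb : 0 < b) (hb1 : b ≤ 1) (hδ : 0 < δ)
    (KQ Kp Ks : VarExp.ExpBounds) :
    -- (i) the Sobolev-Poincaré inequality and its inhomogeneous version
    (∀ m ε : ℝ, 0 < ε → ∃ CS : ℝ, 0 < CS ∧
      ∀ (X : Type v) [MetricSpace X] [MeasurableSpace X] [BorelSpace X]
        (μ : MeasureTheory.Measure X) (Q p s : X → ℝ),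
        VarExp.Setting μ Q p s b δ D KQ Kp Ks →
        μ Set.univ = ENNReal.ofReal m →
        (∀ᵐ x ∂μ, ε ≤ Q x - s x * p x) →
        (∀ u ∈ VarExp.HomSobolev μ s p, ∀ g ∈ VarExp.ScalarGradients μ s u,
          VarExp.MemVarLp μ p g →
          ⨅ c : ℝ, VarExp.luxNorm μ (fun x => Q x * p x / (Q x - s x * p x)) (VarExp.absSub u c)
            ≤ ENNReal.ofReal CS * VarExp.luxNorm μ p g) ∧
        (∀ u ∈ VarExp.Sobolev μ s p, ∀ g ∈ VarExp.ScalarGradients μ s u,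
          VarExp.MemVarLp μ p g →
          VarExp.luxNorm μ (fun x => Q x * p x / (Q x - s x * p x)) (fun x => (u x).abs)
            ≤ ENNReal.ofReal CS *
              (VarExp.luxNorm μ p (fun x => (u x).abs) + VarExp.luxNorm μ p g))) ∧
    -- (ii) the Moser-Trudinger inequality
    (∃ CMT1 CMT2 : ℝ, 0 < CMT1 ∧ 0 < CMT2 ∧
      ∀ (X : Type v) [MetricSpace X] [MeasurableSpace X] [BorelSpace X]
        (μ : MeasureTheory.Measure X) (Q p s : X → ℝ),
        VarExp.Setting μ Q p s b δ D KQ Kp Ks →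
        (∀ x, s x * p x = Q x) →
        ∀ u ∈ VarExp.HomSobolev μ s p, ∀ g ∈ VarExp.ScalarGradients μ s u,
          VarExp.MemVarLp μ p g →
          MeasureTheory.Integrable (fun x => (u x).toReal) μ ∧
          (0 < VarExp.luxNorm μ p g →
            ⨍⁻ x, ENNReal.ofReal (Real.exp
                (CMT1 * (|(u x).toReal - VarExp.mean μ u| / (VarExp.luxNorm μ p g).toReal))) ∂μ
              ≤ ENNReal.ofReal CMT2)) ∧
    -- (iii) the Morrey inequality and the Hölder representative
    (∀ ε : ℝ, 0 < ε → ∃ CH DH : ℝ, 0 < CH ∧ 0 < DH ∧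
      ∀ (X : Type v) [MetricSpace X] [MeasurableSpace X] [BorelSpace X]
        (μ : MeasureTheory.Measure X) (Q p s : X → ℝ),
        VarExp.Setting μ Q p s b δ D KQ Kp Ks →
        (∀ᵐ x ∂μ, ε ≤ s x * p x - Q x) →
        ∀ u ∈ VarExp.HomSobolev μ s p, ∀ g ∈ VarExp.ScalarGradients μ s u,
          VarExp.MemVarLp μ p g →
          MeasureTheory.Integrable (fun x => (u x).toReal) μ ∧
          essSup (VarExp.absSub u (VarExp.mean μ u)) μ
            ≤ ENNReal.ofReal CH * VarExp.luxNorm μ p g ∧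
          ∃ v : X → ℝ, Continuous v ∧ (∀ᵐ x ∂μ, u x = (v x : EReal)) ∧
            ∀ x y : X, ENNReal.ofReal |v x - v y|
              ≤ ENNReal.ofReal DH * VarExp.luxNorm μ p g *
                ENNReal.ofReal (dist x y ^ (s x - Q x / p x))) := by
  let c : VarExp.Params := ⟨b, δ, D, KQ, Kp, Ks, hb, hb1, hδ⟩
  refine ⟨fun m ε hε => ?_, ?_, fun ε hε => ?_⟩
  · have hη := c.gapBound_pos hε
    refine ⟨c.sobolevConst (max m 0) (c.gapBound ε),
      c.sobolevConst_pos (le_max_right m 0) hη, fun X _ _ _ μ Q p s h hm hsub => ?_⟩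
    have hgap := VarExp.Setting.gapBound_le_gap (c := c) h hε hsub
    rw [← ENNReal.toReal_ofReal', ← hm, ← VarExp.inv_gap h.expQ.pos h.expP.pos]
    exact ⟨fun u hu g hg hgp => VarExp.Setting.iInf_luxNorm_absSub_le h hη hgap hu hg hgp,
      fun u hu g hg hgp => VarExp.Setting.luxNorm_abs_le h hη hgap hu hg hgp⟩
  · refine ⟨(2 * c.logConst)⁻¹, Real.exp 1 * (1 + 2 ^ c.startScale),
      inv_pos.2 (mul_pos two_pos c.logConst_pos), by positivity,
      fun X _ _ _ μ Q p s h hcrit u hu g hg hgp => ?_⟩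
    have hgap x := VarExp.gap_eq_zero (h.expQ.pos x) (h.expP.pos x) (hcrit x)
    exact ⟨VarExp.Setting.integrable_of_gap_eq_zero (c := c) h hgap hu hg hgp,
      VarExp.Setting.laverage_exp_abs_sub_mean_le h hgap hu hg hgp⟩
  · have hη := c.gapBound_pos hε
    refine ⟨c.supConst (c.gapBound ε), c.holderConst (c.gapBound ε), c.supConst_pos hη,
      c.holderConst_pos hη, fun X _ _ _ μ Q p s h hsuper u hu g hg hgp => ?_⟩
    have hgap := VarExp.Setting.gap_le_neg_gapBound (c := c) h hε hsuper
    exact ⟨VarExp.Setting.integrable_of_gap_le_neg (c := c) h hη hgap hu hg hgp,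
      VarExp.Setting.essSup_absSub_mean_le h hη hgap hu hg hgp,
      VarExp.Setting.exists_continuous_ae_eq h hη hgap hu hg hgp⟩
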